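/- Let $p$ be a prime and let $K$ be a finite extension of $\mathbb{Q}_p$ with its $p$-adic norm $|\cdot|$, containing an element $\pi$ with $\pi^{p-1}+p=0$. Let $A$ be an $n\times N$ integer matrix of rank $n$ with columns $\mathbf w_1,\dots,\mathbf w_N\in\mathbb Z^n$, let $\Delta\subset\mathbb R^n$ be the convex hull of $\{0,\mathbf w_1,\dots,\mathbf w_N\}$, let $\delta$ be the convex cone generated by $\mathbf w_1,\dots,\mathbf w_N$, and for $\mathbf w\in\delta$ put $d(\mathbf w)=\inf\{a>0:\mathbf w\in a\Delta\}$. For $\mathbf v\in\mathbb Z_{\ge0}^N$ put $|\mathbf v|=v_1+\cdots+v_N$. Let $$K\langle\mathbf x\rangle^\dagger=\bigcup_{r>1}\Big\{\sum_{\mathbf v\in\mathbb Z_{\ge 0}^N}a_{\mathbf v}\mathbf x^{\mathbf v}:\ a_{\mathbf v}\in K,\ |a_{\mathbf v}|r^{|\mathbf v|}\text{ bounded}\Big\},$$ $$L^\dagger=\bigcup_{r>1,\,s>1}\Big\{\sum_{\mathbf v\in\mathbb Z_{\ge 0}^N,\ \mathbf w\in\mathbb Z^n\cap\delta}a_{\mathbf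 v\mathbf w}\mathbf x^{\mathbf v}\mathbf t^{\mathbf w}:\ a_{\mathbf v\mathbf w}\in K,\ |a_{\mathbf v\mathbf w}|r^{|\mathbf v|}s^{d(\mathbf w)}\text{ bounded}\Big\}.$$ These are rings under multiplication of series, and $L^\dagger$ is a $K\langle\mathbf x\rangle^\dagger$-algebra. Let $K'$ be a finite extension of $K$ with its $p$-adic norm, let $\mathbf a=(a_1,\dots,a_N)\in K'^N$ with $|a_i|\le 1$ for all $i$, regard $K'$ as a $K\langle\mathbf x\rangle^\dagger$-algebra via $f\mapsto f(\mathbf a)$, and let $$L_0^\dagger=\bigcup_{s>1}\Big\{\sum_{\mathbf w\in\mathbb Z^n\cap\delta}a_{\mathbf w}\mathbf t^{\mathbf w}:\ a_{\mathbf w}\in K',\ |a_{\mathbf w}|s^{d(\mathbf w)}\text{ bounded}\Big\}.$$ Then $L^\dagger$ is flat over $K\langle\mathbf x\rangle^\dagger$, and there is an isomorphism of $K'$-algebras $$L^\dagger\otimes_{K\langle\mathbf x\rangle^\dagger}K'\ \cong\ L_0^\dagger,\qquad \Big(\sum_{\mathbf w}f_{\mathbf w}(\mathbf x)\mathbf t^{\mathbf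 w}\Big)\otimes c\ \mapsto\ \sum_{\mathbf w}c\,f_{\mathbf w}(\mathbf a)\,\mathbf t^{\mathbf w}.$$ -/

import Mathlib

open Filter Topology
open scoped TensorProduct Pointwise

noncomputable section

namespace GKZ

/-! ### Finite extensions of `ℚ_p`

A finite extension `K` of `ℚ_p` with its `p`-adic norm is a normed field that is a normed algebra of
finite dimension over `ℚ_[p]`.  Such a norm is complete and ultrametric. -/

section Padic

variable (p : ℕ) [Fact p.Prime] (K : Type*) [NormedField K]

theorem isUltrametricDist [NormedAlgebra ℚ_[p] K] : IsUltrametricDist K := by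
  refine IsUltrametricDist.isUltrametricDist_of_forall_norm_natCast_le_one fun m => ?_
  have h := norm_algebraMap' K (m : ℚ_[p])
  rw [map_natCast] at h
  rw [h]
  exact IsUltrametricDist.norm_natCast_le_one ℚ_[p] m

theorem completeSpace [NormedAlgebra ℚ_[p] K] [FiniteDimensional ℚ_[p] K] : CompleteSpace K :=
  FiniteDimensional.complete ℚ_[p] K

end Padic

/-! ### Sums over the fibres of a map -/

section Push

variable {K : Type*} [NormedField K] {X Y Z : Type*}

open scoped Classical in
/-- The function `y ↦ ∑_{π x = y} H x`. -/
def push (π : X → Y) (H : X → K) (y : Y) : K := ∑' x, if π x = y then H x else 0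

theorem tendsto_ite {P : X → Prop} [DecidablePred P] {H : X → K}
    (hH : Tendsto H cofinite (𝓝 0)) :
    Tendsto (fun x => if P x then H x else 0) cofinite (𝓝 0) := by
  refine squeeze_zero_norm (fun x => ?_) (tendsto_norm_zero.comp hH)
  by_cases h : P x <;> simp [h]

theorem push_id (f : X → K) : push id f = f := by
  classical
  funext x
  rw [push, tsum_eq_single x (fun y hy => by simp [hy])]
  simp

variable [IsUltrametricDist K]

theorem push_tendsto (π : X → Y) {H : X → K} (hH : Tendsto H cofinite (𝓝 0)) :
    Tendsto (push π H) cofinite (𝓝 0) := by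
  classical
  rw [Metric.tendsto_nhds] at hH ⊢
  intro ε hε
  have hf := hH (ε / 2) (by positivity)
  rw [eventually_cofinite] at hf ⊢
  refine (hf.image π).subset fun y hy => ?_
  by_contra hcon
  apply hy
  have : ‖push π H y‖ ≤ ε / 2 := by
    refine IsUltrametricDist.norm_tsum_le_of_forall_le_of_nonneg (by positivity) fun x => ?_
    by_cases h : π x = y
    · rw [if_pos h]
      by_contra h2
      apply hcon
      refine ⟨x, ?_, h⟩
      simp only [Set.mem_ofPred_eq, dist_zero_right, not_lt]
      exact (not_le.mp h2).le
    · rw [if_neg h, norm_zero]; positivity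
  rw [dist_zero_right]
  linarith

variable [CompleteSpace K]

theorem summable_of_tendsto {H : X → K} (hH : Tendsto H cofinite (𝓝 0)) : Summable H :=
  NonarchimedeanAddGroup.summable_of_tendsto_cofinite_zero hH

theorem push_push (π : X → Y) (σ : Y → Z) {H : X → K} (hH : Tendsto H cofinite (𝓝 0)) :
    push σ (push π H) = push (σ ∘ π) H := by
  classical
  funext z
  have hs : Summable fun x => if (σ ∘ π) x = z then H x else 0 :=
    summable_of_tendsto (tendsto_ite hH)
  have h := hs.hasSum.tsum_fiberwise π
  rw [push, push, ← h.tsum_eq]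
  refine tsum_congr fun y => ?_
  rw [tsum_subtype (π ⁻¹' {y}) fun x => if (σ ∘ π) x = z then H x else 0]
  by_cases hy : σ y = z
  · rw [if_pos hy, push]
    refine tsum_congr fun x => ?_
    by_cases hx : π x = y
    · simp [hx, hy]
    · simp [hx]
  · rw [if_neg hy, eq_comm]
    convert tsum_zero with x
    by_cases hx : π x = y
    · simp [hx, hy]
    · simp [hx]

theorem push_prod {X' Y' : Type*} (π : X → Y) (σ : X' → Y') {f : X → K} {g : X' → K}
    (hf : Tendsto f cofinite (𝓝 0)) (hg : Tendsto g cofinite (𝓝 0)) :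
    (fun q : Y × Y' => push π f q.1 * push σ g q.2) =
      push (Prod.map π σ) (fun q : X × X' => f q.1 * g q.2) := by
  classical
  have : NonarchimedeanRing K := ⟨NonarchimedeanAddGroup.is_nonarchimedean⟩
  funext ⟨a, b⟩
  rw [push, push, push, tsum_mul_tsum_of_nonarchimedean (summable_of_tendsto (tendsto_ite hf))
    (summable_of_tendsto (tendsto_ite hg))]
  refine tsum_congr fun q => ?_
  by_cases h1 : π q.1 = a <;> by_cases h2 : σ q.2 = b <;> simp [h1, h2, Prod.ext_iff]

end Push

/-! ### Formal sums `∑_m a_m t^m` with `a_m → 0`, and their convolution product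

All rings of series below consist of families of this kind; the convolution product is their
multiplication, with infinite sums as soon as an exponent is a sum of two exponents in infinitely
many ways. -/

/-- Families of elements of `K`, indexed by `M`, that tend to zero along the cofinite filter. -/
def nullFam (p : ℕ) [Fact p.Prime] (K : Type*) [NormedField K] [NormedAlgebra ℚ_[p] K]
    (M : Type*) : Submodule K (M → K) where
  carrier := {f | Tendsto f cofinite (𝓝 0)}
  add_mem' := fun {f g} hf hg => by
    have h := Tendsto.add (f := f) (g := g) hf hg
    rw [add_zero] at h
    exact h
  zero_mem' := tendsto_const_nhds
  smul_mem' := fun c f hf => by simpa using! Tendsto.const_mul (f := f) c hf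

section NullFam

variable {p : ℕ} [Fact p.Prime] {K : Type*} [NormedField K] [NormedAlgebra ℚ_[p] K]
  {M : Type*} [AddCommMonoid M]

/-- The convolution `(f g)_m = ∑_{m' + m'' = m} f_{m'} g_{m''}`. -/
def conv (f g : M → K) (m : M) : K :=
  ∑' q : {q : M × M // q.1 + q.2 = m}, f q.1.1 * g q.1.2

theorem conv_eq_push (f g : M → K) :
    conv f g = push (fun q : M × M => q.1 + q.2) fun q => f q.1 * g q.2 := by
  classical
  funext m
  have h := tsum_subtype {q : M × M | q.1 + q.2 = m} fun q => f q.1 * g q.2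
  rw [push]
  refine Eq.trans h (tsum_congr fun q => ?_)
  by_cases hq : q.1 + q.2 = m <;> simp [hq]

open scoped Classical in
theorem conv_apply (f g : M → K) (m : M) :
    conv f g m = ∑' q : M × M, if q.1 + q.2 = m then f q.1 * g q.2 else 0 := by
  rw [conv_eq_push]
  unfold push
  refine tsum_congr fun q => ?_
  congr

theorem conv_comm (f g : M → K) : conv f g = conv g f := by
  classical
  funext m
  rw [conv_apply, conv_apply, ← (Equiv.prodComm M M).tsum_eq]
  refine tsum_congr fun q => ?_
  simp [add_comm, mul_comm]

theorem prod_tendsto {X X' : Type*} {f : X → K} {g : X' → K} (hf : Tendsto f cofinite (𝓝 0))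
    (hg : Tendsto g cofinite (𝓝 0)) :
    Tendsto (fun q : X × X' => f q.1 * g q.2) cofinite (𝓝 0) :=
  tendsto_mul_cofinite_nhds_zero hf hg

open scoped Classical in
theorem single_tendsto : Tendsto (Pi.single (0 : M) (1 : K) : M → K) cofinite (𝓝 0) := by
  refine tendsto_nhds_of_eventually_eq ?_
  rw [eventually_cofinite]
  refine (Set.finite_singleton (0 : M)).subset fun m hm => ?_
  by_contra h
  exact hm (by simp [show m ≠ 0 from h])

open scoped Classical in
theorem one_conv (f : M → K) : conv (Pi.single 0 1) f = f := by
  funext m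
  rw [conv_apply, tsum_eq_single (0, m)]
  · simp
  · rintro ⟨x, y⟩ h
    by_cases hx : x = 0
    · subst hx
      have : y ≠ m := fun hy => h (by rw [hy])
      simp [this]
    · simp [hx]

section Ultra

variable [IsUltrametricDist K]

theorem conv_tendsto {f g : M → K} (hf : Tendsto f cofinite (𝓝 0))
    (hg : Tendsto g cofinite (𝓝 0)) : Tendsto (conv f g) cofinite (𝓝 0) := by
  rw [conv_eq_push]
  exact push_tendsto _ (prod_tendsto hf hg)

theorem conv_norm_le {f g : M → K} {ρ : M → ℝ} (h0 : ∀ m, 0 < ρ m)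
    (hρ : ∀ m m', ρ (m + m') ≤ ρ m * ρ m') {C D : ℝ} (hf : ∀ m, ‖f m‖ * ρ m ≤ C)
    (hg : ∀ m, ‖g m‖ * ρ m ≤ D) (m : M) : ‖conv f g m‖ * ρ m ≤ C * D := by
  have hC : 0 ≤ C := le_trans (mul_nonneg (norm_nonneg _) (h0 m).le) (hf m)
  have hD : 0 ≤ D := le_trans (mul_nonneg (norm_nonneg _) (h0 m).le) (hg m)
  rw [← le_div_iff₀ (h0 m)]
  refine IsUltrametricDist.norm_tsum_le_of_forall_le_of_nonneg
    (div_nonneg (mul_nonneg hC hD) (h0 m).le) ?_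
  rintro ⟨⟨x, y⟩, h⟩
  change x + y = m at h
  subst h
  rw [le_div_iff₀ (h0 _)]
  calc ‖f x * g y‖ * ρ (x + y) ≤ ‖f x * g y‖ * (ρ x * ρ y) :=
        mul_le_mul_of_nonneg_left (hρ x y) (norm_nonneg _)
    _ = (‖f x‖ * ρ x) * (‖g y‖ * ρ y) := by rw [norm_mul]; ring
    _ ≤ C * D := mul_le_mul (hf x) (hg y) (mul_nonneg (norm_nonneg _) (h0 y).le) hC

variable [CompleteSpace K]

theorem conv_assoc {f g h : M → K} (hf : Tendsto f cofinite (𝓝 0))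
    (hg : Tendsto g cofinite (𝓝 0)) (hh : Tendsto h cofinite (𝓝 0)) :
    conv (conv f g) h = conv f (conv g h) := by
  have hfg := prod_tendsto hf hg
  have hgh := prod_tendsto hg hh
  have e1 : (fun q : M × M => conv f g q.1 * h q.2) =
      push (Prod.map (fun q : M × M => q.1 + q.2) id)
        (fun q : (M × M) × M => (f q.1.1 * g q.1.2) * h q.2) := by
    rw [← push_prod _ _ hfg hh, push_id, conv_eq_push]
  have e2 : (fun q : M × M => f q.1 * conv g h q.2) =
      push (Prod.map id (fun q : M × M => q.1 + q.2))
        (fun q : M × (M × M) => f q.1 * (g q.2.1 * h q.2.2)) := by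
    rw [← push_prod _ _ hf hgh, push_id, conv_eq_push]
  rw [conv_eq_push (conv f g) h, conv_eq_push f (conv g h), e1, e2, push_push _ _ (prod_tendsto hfg hh),
    push_push _ _ (prod_tendsto hf hgh)]
  funext m
  rw [push, push, ← (Equiv.prodAssoc M M M).tsum_eq]
  refine tsum_congr ?_
  rintro ⟨⟨x, y⟩, z⟩
  by_cases hm : x + (y + z) = m
  · exact ((if_pos (show x + y + z = m by rw [add_assoc, hm])).trans (mul_assoc _ _ _)).trans
      (if_pos hm).symm
  · exact (if_neg (show ¬ x + y + z = m by rw [add_assoc]; exact hm)).trans (if_neg hm).symm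

theorem conv_add {f g h : M → K} (hf : Tendsto f cofinite (𝓝 0))
    (hg : Tendsto g cofinite (𝓝 0)) (hh : Tendsto h cofinite (𝓝 0)) :
    conv f (g + h) = conv f g + conv f h := by
  classical
  funext m
  rw [Pi.add_apply, conv_apply, conv_apply, conv_apply, ← Summable.tsum_add
    (summable_of_tendsto (tendsto_ite (prod_tendsto hf hg)))
    (summable_of_tendsto (tendsto_ite (prod_tendsto hf hh)))]
  refine tsum_congr fun q => ?_
  by_cases hq : q.1 + q.2 = m <;> simp [hq, mul_add]

end Ultra

theorem smul_conv (c : K) (f g : M → K) : conv (c • f) g = c • conv f g := by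
  funext m
  simp only [conv, Pi.smul_apply, smul_eq_mul, mul_assoc, tsum_mul_left]

variable [FiniteDimensional ℚ_[p] K]

open scoped Classical in
/-- The convolution ring of null families, with unit `t^0`. -/
instance : CommRing (nullFam p K M) :=
  haveI := isUltrametricDist p K
  haveI := completeSpace p K
  { (inferInstance : AddCommGroup (nullFam p K M)) with
    mul := fun f g => ⟨conv f.1 g.1, conv_tendsto f.2 g.2⟩
    one := ⟨Pi.single 0 1, single_tendsto⟩
    mul_assoc := fun f g h => Subtype.ext (conv_assoc f.2 g.2 h.2)
    mul_comm := fun f g => Subtype.ext (conv_comm f.1 g.1)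
    one_mul := fun f => Subtype.ext (one_conv f.1)
    mul_one := fun f => Subtype.ext ((conv_comm _ _).trans (one_conv f.1))
    left_distrib := fun f g h => Subtype.ext (conv_add f.2 g.2 h.2)
    right_distrib := fun f g h => Subtype.ext <| by
      change conv (f.1 + g.1) h.1 = conv f.1 h.1 + conv g.1 h.1
      rw [conv_comm, conv_add h.2 f.2 g.2, conv_comm h.1, conv_comm h.1]
    zero_mul := fun f => Subtype.ext <| by
      change conv (0 : M → K) f.1 = 0
      funext m
      simp [conv]
    mul_zero := fun f => Subtype.ext <| by
      change conv f.1 (0 : M → K) = 0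
      funext m
      simp [conv] }

theorem coe_mul (f g : nullFam p K M) : (f * g).1 = conv f.1 g.1 := rfl

open scoped Classical in
theorem coe_one : (1 : nullFam p K M).1 = Pi.single 0 1 := rfl

theorem coe_one_apply (m : M) [Decidable (m = 0)] :
    (1 : nullFam p K M).1 m = if m = 0 then 1 else 0 := by
  classical
  rw [coe_one]
  by_cases h : m = 0
  · subst h
    rw [if_pos rfl, Pi.single_eq_same]
  · rw [if_neg h, Pi.single_eq_of_ne h]

instance : Algebra K (nullFam p K M) :=
  Algebra.ofModule (fun c f g => Subtype.ext (smul_conv c f.1 g.1)) fun c f g =>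
    Subtype.ext <| by
      change conv f.1 (c • g.1) = c • conv f.1 g.1
      rw [conv_comm, smul_conv, conv_comm]

open scoped Classical in
theorem coe_algebraMap (c : K) :
    (algebraMap K (nullFam p K M) c).1 = c • (Pi.single 0 1 : M → K) := by
  rw [Algebra.algebraMap_eq_smul_one]
  rfl

end NullFam

/-! ### The cone, the polytope and the degree function -/

section Cone

variable {n N : ℕ} (A : Matrix (Fin n) (Fin N) ℤ)

/-- The `j`-th column of `A`, as a vector of `ℝⁿ`. -/
def col (j : Fin N) : Fin n → ℝ := fun i => (A i j : ℝ)

/-- The convex hull `Δ` of `0` and the columns of `A`. -/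
def polytope : Set (Fin n → ℝ) := convexHull ℝ (insert 0 (Set.range (col A)))

/-- The convex polyhedral cone `δ` generated by the columns of `A`. -/
def cone : PointedCone ℝ (Fin n → ℝ) := PointedCone.hull ℝ (Set.range (col A))

/-- An integral vector as a real vector. -/
def toReal : (Fin n → ℤ) →+ (Fin n → ℝ) where
  toFun w i := (w i : ℝ)
  map_zero' := by ext; simp
  map_add' _ _ := by ext; simp

/-- The monoid `ℤⁿ ∩ δ`. -/
def coneLattice : AddSubmonoid (Fin n → ℤ) := (cone A).toAddSubmonoid.comap toReal

/-- `d(w) = inf {a > 0 : w ∈ a Δ}`. -/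
def deg (w : Fin n → ℝ) : ℝ := sInf {a : ℝ | 0 < a ∧ w ∈ a • polytope A}

/-- The function `d` on `ℤⁿ ∩ δ`. -/
def latticeDeg (w : coneLattice A) : ℝ := deg A (toReal w.1)

theorem polytope_convex : Convex ℝ (polytope A) := convex_convexHull ℝ _

theorem zero_mem_polytope : (0 : Fin n → ℝ) ∈ polytope A :=
  subset_convexHull ℝ _ (Set.mem_insert _ _)

theorem deg_bddBelow (w : Fin n → ℝ) : BddBelow {a : ℝ | 0 < a ∧ w ∈ a • polytope A} :=
  ⟨0, fun _ h => h.1.le⟩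

theorem deg_nonneg (w : Fin n → ℝ) : 0 ≤ deg A w := Real.sInf_nonneg fun _ h => h.1.le

theorem deg_zero : deg A 0 = 0 := by
  refine le_antisymm (le_of_forall_pos_le_add fun ε hε => ?_) (deg_nonneg A 0)
  rw [zero_add]
  exact csInf_le (deg_bddBelow A 0) ⟨hε, ⟨0, zero_mem_polytope A, smul_zero ε⟩⟩

theorem add_mem_smul_polytope {a b : ℝ} {x y : Fin n → ℝ} (ha : 0 < a) (hb : 0 < b)
    (hx : x ∈ a • polytope A) (hy : y ∈ b • polytope A) : x + y ∈ (a + b) • polytope A := by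
  rw [(polytope_convex A).add_smul ha.le hb.le]
  exact Set.add_mem_add hx hy

theorem deg_set_nonempty {w : Fin n → ℝ} (hw : w ∈ cone A) :
    {a : ℝ | 0 < a ∧ w ∈ a • polytope A}.Nonempty := by
  unfold cone at hw
  induction hw using Submodule.span_induction with
  | mem x hx =>
    exact ⟨1, one_pos, by
      rw [one_smul]; exact subset_convexHull ℝ _ (Set.mem_insert_of_mem _ hx)⟩
  | zero => exact ⟨1, one_pos, by rw [one_smul]; exact zero_mem_polytope A⟩
  | add x y _ _ hx hy =>
    obtain ⟨a, ha, hxa⟩ := hx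
    obtain ⟨b, hb, hyb⟩ := hy
    exact ⟨a + b, add_pos ha hb, add_mem_smul_polytope A ha hb hxa hyb⟩
  | smul c x _ hx =>
    obtain ⟨a, ha, z, hz, rfl⟩ := hx
    rcases c.2.eq_or_lt with h | h
    · refine ⟨1, one_pos, ?_⟩
      have : c = 0 := Subtype.ext h.symm
      rw [this, zero_smul, one_smul]
      exact zero_mem_polytope A
    · exact ⟨c.1 * a, mul_pos h ha, z, hz, by
        change (c.1 * a) • z = c.1 • (a • z)
        rw [mul_smul]⟩

theorem deg_add_le {x y : Fin n → ℝ} (hx : x ∈ cone A) (hy : y ∈ cone A) :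
    deg A (x + y) ≤ deg A x + deg A y := by
  refine le_of_forall_pos_le_add fun ε hε => ?_
  obtain ⟨a, ⟨ha, hxa⟩, ha'⟩ := Real.lt_sInf_add_pos (deg_set_nonempty A hx) (half_pos hε)
  obtain ⟨b, ⟨hb, hyb⟩, hb'⟩ := Real.lt_sInf_add_pos (deg_set_nonempty A hy) (half_pos hε)
  have h : deg A (x + y) ≤ a + b :=
    csInf_le (deg_bddBelow A _) ⟨add_pos ha hb, add_mem_smul_polytope A ha hb hxa hyb⟩
  change a < deg A x + ε / 2 at ha'
  change b < deg A y + ε / 2 at hb'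
  linarith

theorem latticeDeg_nonneg (w : coneLattice A) : 0 ≤ latticeDeg A w := deg_nonneg A _

theorem latticeDeg_zero : latticeDeg A 0 = 0 := by
  rw [latticeDeg, show toReal (0 : coneLattice A).1 = (0 : Fin n → ℝ) from map_zero _]
  exact deg_zero A

theorem latticeDeg_add_le (w w' : coneLattice A) :
    latticeDeg A (w + w') ≤ latticeDeg A w + latticeDeg A w' := by
  rw [latticeDeg, show toReal (w + w').1 = toReal w.1 + toReal w'.1 from map_add _ _ _]
  exact deg_add_le A w.2 w'.2

theorem finite_latticeDeg_le (c : ℝ) : {w : coneLattice A | latticeDeg A w ≤ c}.Finite := by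
  have hb : Bornology.IsBounded (polytope A) :=
    isBounded_convexHull.mpr ((Set.finite_range (col A)).insert 0).isBounded
  obtain ⟨B, hB⟩ := hb.exists_norm_le
  have hB0 : 0 ≤ B := le_trans (norm_nonneg _) (hB 0 (zero_mem_polytope A))
  have key : ∀ w : coneLattice A, latticeDeg A w ≤ c → ∀ i, |(w.1 i : ℝ)| ≤ (c + 1) * B := by
    intro w hw i
    obtain ⟨a, ⟨ha, z, hz, hza⟩, ha'⟩ := Real.lt_sInf_add_pos (deg_set_nonempty A w.2) one_pos
    change a < latticeDeg A w + 1 at ha'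
    have h1 : ‖toReal w.1‖ ≤ a * B := by
      rw [← hza]
      change ‖a • z‖ ≤ a * B
      rw [norm_smul, Real.norm_of_nonneg ha.le]
      exact mul_le_mul_of_nonneg_left (hB z hz) ha.le
    calc |(w.1 i : ℝ)| = ‖toReal w.1 i‖ := rfl
      _ ≤ ‖toReal w.1‖ := norm_le_pi_norm _ i
      _ ≤ a * B := h1
      _ ≤ (c + 1) * B := mul_le_mul_of_nonneg_right (by linarith) hB0
  obtain ⟨m, hm⟩ := exists_nat_ge ((c + 1) * B)
  refine Set.Finite.of_finite_image (f := Subtype.val) ?_ Subtype.val_injective.injOn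
  refine (Set.finite_Icc (fun _ : Fin n => -(m : ℤ)) fun _ => (m : ℤ)).subset ?_
  rintro _ ⟨w, hw, rfl⟩
  have h := fun i => abs_le.mp ((key w hw i).trans hm)
  exact ⟨fun i => by exact_mod_cast (h i).1, fun i => by exact_mod_cast (h i).2⟩

end Cone

/-! ### Weights -/

section Weights

variable {n N : ℕ} (A : Matrix (Fin n) (Fin N) ℤ)

/-- The weight `r^{|v|} s^{d(w)}` of the monomial `x^v t^w`, where `|v| = v_1 + ⋯ + v_N`. -/
def weight (r s : ℝ) (m : (Fin N →₀ ℕ) × coneLattice A) : ℝ :=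
  r ^ m.1.degree * s ^ latticeDeg A m.2

theorem weight_pos {r s : ℝ} (hr : 1 < r) (hs : 1 < s) (m : (Fin N →₀ ℕ) × coneLattice A) :
    0 < weight A r s m := by
  have : 0 < r := by linarith
  have : 0 < s := by linarith
  unfold weight
  positivity

theorem weight_mono {r r' s s' : ℝ} (hr : 1 < r) (hs : 1 < s) (hr' : r ≤ r') (hs' : s ≤ s')
    (m : (Fin N →₀ ℕ) × coneLattice A) : weight A r s m ≤ weight A r' s' m := by
  have h1 : 0 < r := by linarith
  have h2 : 0 < s := by linarith
  exact mul_le_mul (pow_le_pow_left₀ h1.le hr' _)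
    (Real.rpow_le_rpow h2.le hs' (latticeDeg_nonneg A _)) (by positivity)
    (pow_nonneg (h1.le.trans hr') _)

theorem weight_zero (r s : ℝ) : weight A r s 0 = 1 := by
  simp [weight, latticeDeg_zero]

theorem rpow_latticeDeg_add_le {s : ℝ} (hs : 1 < s) (w w' : coneLattice A) :
    s ^ latticeDeg A (w + w') ≤ s ^ latticeDeg A w * s ^ latticeDeg A w' := by
  rw [← Real.rpow_add (by linarith)]
  exact Real.rpow_le_rpow_of_exponent_le hs.le (latticeDeg_add_le A w w')

theorem weight_add_le {r s : ℝ} (hr : 1 < r) (hs : 1 < s)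
    (m m' : (Fin N →₀ ℕ) × coneLattice A) :
    weight A r s (m + m') ≤ weight A r s m * weight A r s m' := by
  have h1 : 0 < r := by linarith
  calc weight A r s (m + m')
      = r ^ m.1.degree * r ^ m'.1.degree * s ^ latticeDeg A (m.2 + m'.2) := by
        rw [weight, Prod.fst_add, Prod.snd_add, map_add, pow_add]
    _ ≤ r ^ m.1.degree * r ^ m'.1.degree * (s ^ latticeDeg A m.2 * s ^ latticeDeg A m'.2) :=
        mul_le_mul_of_nonneg_left (rpow_latticeDeg_add_le A hs _ _) (by positivity)
    _ = weight A r s m * weight A r s m' := by unfold weight; ring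

theorem finite_degree_le (k : ℕ) : {v : Fin N →₀ ℕ | v.degree ≤ k}.Finite := by
  refine Set.Finite.of_finite_image (f := fun v : Fin N →₀ ℕ => (v : Fin N → ℕ)) ?_
    DFunLike.coe_injective.injOn
  refine (Set.finite_Icc (fun _ : Fin N => 0) fun _ => k).subset ?_
  rintro _ ⟨v, hv, rfl⟩
  exact ⟨fun i => Nat.zero_le _, fun i => (Finsupp.le_degree i v).trans hv⟩

theorem tendsto_of_weight {K X : Type*} [NormedField K] {f : X → K} {ρ : X → ℝ}
    (h0 : ∀ m, 0 < ρ m) (hfin : ∀ c : ℝ, {m | ρ m ≤ c}.Finite) {C : ℝ}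
    (hf : ∀ m, ‖f m‖ * ρ m ≤ C) : Tendsto f cofinite (𝓝 0) := by
  rw [Metric.tendsto_nhds]
  intro ε hε
  rw [eventually_cofinite]
  refine (hfin (C / ε)).subset fun m hm => ?_
  simp only [dist_zero_right, not_lt, Set.mem_ofPred_eq] at hm ⊢
  rw [le_div_iff₀ hε]
  calc ρ m * ε ≤ ρ m * ‖f m‖ := mul_le_mul_of_nonneg_left hm (h0 m).le
    _ ≤ C := by rw [mul_comm]; exact hf m

theorem exists_rpow_le {s : ℝ} (hs : 1 < s) (c : ℝ) : ∃ b : ℝ, ∀ x : ℝ, s ^ x ≤ c → x ≤ b := by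
  obtain ⟨b, hb⟩ := pow_unbounded_of_one_lt c hs
  refine ⟨b, fun x hx => ?_⟩
  by_contra h
  have := Real.rpow_le_rpow_of_exponent_le hs.le (not_le.mp h).le
  rw [Real.rpow_natCast] at this
  linarith

theorem finite_rpow_latticeDeg_le {s : ℝ} (hs : 1 < s) (c : ℝ) :
    {w : coneLattice A | s ^ latticeDeg A w ≤ c}.Finite := by
  obtain ⟨b, hb⟩ := exists_rpow_le hs c
  exact (finite_latticeDeg_le A b).subset fun w hw => hb _ hw

theorem finite_pow_degree_le {r : ℝ} (hr : 1 < r) (c : ℝ) :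
    {v : Fin N →₀ ℕ | r ^ v.degree ≤ c}.Finite := by
  obtain ⟨k, hk⟩ := pow_unbounded_of_one_lt c hr
  refine (finite_degree_le k).subset fun v hv => ?_
  by_contra h
  have h1 := pow_le_pow_right₀ hr.le (not_le.mp h).le
  have h2 : r ^ v.degree ≤ c := hv
  linarith

theorem finite_weight_le {r s : ℝ} (hr : 1 < r) (hs : 1 < s) (c : ℝ) :
    {m | weight A r s m ≤ c}.Finite := by
  refine ((finite_pow_degree_le hr c).prod (finite_rpow_latticeDeg_le A hs c)).subset ?_
  rintro ⟨v, w⟩ h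
  have h1 : 1 ≤ r ^ v.degree := one_le_pow₀ hr.le
  have h2 : 1 ≤ s ^ latticeDeg A w := Real.one_le_rpow hs.le (latticeDeg_nonneg A w)
  have h3 : r ^ v.degree * s ^ latticeDeg A w ≤ c := h
  exact ⟨by change r ^ v.degree ≤ c; nlinarith, by change s ^ latticeDeg A w ≤ c; nlinarith⟩

end Weights

/-! ### The rings `K⟨x⟩†`, `L†` and `L₀†` -/

section Rings

variable (p : ℕ) [Fact p.Prime] (K : Type*) [NormedField K] [NormedAlgebra ℚ_[p] K]

/-- The algebra `K⟨x⟩†` of overconvergent power series: the power series `∑ a_v x^v` such that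
`|a_v| r^{|v|}` is bounded for some `r > 1`. -/
def OverconvergentSeries (N : ℕ) : Subalgebra K (MvPowerSeries (Fin N) K) where
  carrier := {f | ∃ r : ℝ, 1 < r ∧ ∃ C : ℝ, ∀ v : Fin N →₀ ℕ,
    ‖MvPowerSeries.coeff v f‖ * r ^ v.degree ≤ C}
  mul_mem' := by
    rintro f g ⟨r, hr, C, hC⟩ ⟨r', hr', D, hD⟩
    classical
    have := isUltrametricDist p K
    have hm : 1 < min r r' := lt_min hr hr'
    have hm0 : 0 < min r r' := by linarith
    have hC' : ∀ v, ‖MvPowerSeries.coeff v f‖ * min r r' ^ v.degree ≤ C := fun v =>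
      (mul_le_mul_of_nonneg_left (pow_le_pow_left₀ hm0.le (min_le_left _ _) _)
        (norm_nonneg _)).trans (hC v)
    have hD' : ∀ v, ‖MvPowerSeries.coeff v g‖ * min r r' ^ v.degree ≤ D := fun v =>
      (mul_le_mul_of_nonneg_left (pow_le_pow_left₀ hm0.le (min_le_right _ _) _)
        (norm_nonneg _)).trans (hD v)
    have hC0 : 0 ≤ C := le_trans (by positivity) (hC' 0)
    have hD0 : 0 ≤ D := le_trans (by positivity) (hD' 0)
    refine ⟨min r r', hm, C * D, fun v => ?_⟩
    rw [← le_div_iff₀ (by positivity), MvPowerSeries.coeff_mul]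
    refine IsUltrametricDist.norm_sum_le_of_forall_le_of_nonneg (by positivity) fun q hq => ?_
    rw [le_div_iff₀ (by positivity), ← Finset.HasAntidiagonal.mem_antidiagonal.mp hq, map_add, pow_add, norm_mul]
    calc _ = (‖MvPowerSeries.coeff q.1 f‖ * min r r' ^ q.1.degree) *
          (‖MvPowerSeries.coeff q.2 g‖ * min r r' ^ q.2.degree) := by ring
      _ ≤ C * D := mul_le_mul (hC' _) (hD' _) (by positivity) hC0
  add_mem' := by
    rintro f g ⟨r, hr, C, hC⟩ ⟨r', hr', D, hD⟩
    have hm : 1 < min r r' := lt_min hr hr'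
    have hm0 : 0 < min r r' := by linarith
    refine ⟨min r r', hm, C + D, fun v => ?_⟩
    calc ‖MvPowerSeries.coeff v (f + g)‖ * min r r' ^ v.degree
        ≤ (‖MvPowerSeries.coeff v f‖ + ‖MvPowerSeries.coeff v g‖) * min r r' ^ v.degree := by
          rw [map_add]
          exact mul_le_mul_of_nonneg_right (norm_add_le _ _) (by positivity)
      _ = ‖MvPowerSeries.coeff v f‖ * min r r' ^ v.degree +
          ‖MvPowerSeries.coeff v g‖ * min r r' ^ v.degree := by ring
      _ ≤ C + D := add_le_add
          ((mul_le_mul_of_nonneg_left (pow_le_pow_left₀ hm0.le (min_le_left _ _) _)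
            (norm_nonneg _)).trans (hC v))
          ((mul_le_mul_of_nonneg_left (pow_le_pow_left₀ hm0.le (min_le_right _ _) _)
            (norm_nonneg _)).trans (hD v))
  algebraMap_mem' := fun c => by
    classical
    refine ⟨2, one_lt_two, ‖c‖, fun v => ?_⟩
    rw [MvPowerSeries.algebraMap_apply, MvPowerSeries.coeff_C]
    by_cases h : v = 0 <;> simp [h]

variable {n N : ℕ} (A : Matrix (Fin n) (Fin N) ℤ)

section Bounds

variable {p K} {M : Type*}

theorem add_norm_le {f g : M → K} {ρ : M → ℝ} (h0 : ∀ m, 0 < ρ m) {C D : ℝ}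
    (hf : ∀ m, ‖f m‖ * ρ m ≤ C) (hg : ∀ m, ‖g m‖ * ρ m ≤ D) (m : M) :
    ‖(f + g) m‖ * ρ m ≤ C + D := by
  calc ‖(f + g) m‖ * ρ m ≤ (‖f m‖ + ‖g m‖) * ρ m :=
        mul_le_mul_of_nonneg_right (norm_add_le _ _) (h0 m).le
    _ = ‖f m‖ * ρ m + ‖g m‖ * ρ m := by ring
    _ ≤ C + D := add_le_add (hf m) (hg m)

theorem algebraMap_norm_le [AddCommMonoid M] [FiniteDimensional ℚ_[p] K] (c : K) {ρ : M → ℝ} (h0 : ρ 0 = 1)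
    (m : M) : ‖(algebraMap K (nullFam p K M) c).1 m‖ * ρ m ≤ ‖c‖ := by
  classical
  rw [coe_algebraMap]
  by_cases h : m = 0
  · subst h; simp [h0]
  · simp [h]

end Bounds

theorem tendsto_of_bounded_weight {f : (Fin N →₀ ℕ) × coneLattice A → K} {r s C : ℝ} (hr : 1 < r)
    (hs : 1 < s) (hf : ∀ v w, ‖f (v, w)‖ * (r ^ v.degree * s ^ latticeDeg A w) ≤ C) :
    f ∈ nullFam p K ((Fin N →₀ ℕ) × coneLattice A) :=
  tendsto_of_weight (ρ := weight A r s) (weight_pos A hr hs) (finite_weight_le A hr hs)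
    fun m => hf m.1 m.2

theorem tendsto_of_bounded_rpow {f : coneLattice A → K} {s C : ℝ} (hs : 1 < s)
    (hf : ∀ w, ‖f w‖ * s ^ latticeDeg A w ≤ C) : f ∈ nullFam p K (coneLattice A) :=
  tendsto_of_weight (fun w => Real.rpow_pos_of_pos (by linarith) _)
    (finite_rpow_latticeDeg_le A hs) hf

theorem OverconvergentSeries.tendsto (f : OverconvergentSeries p K N) :
    Tendsto (fun v => MvPowerSeries.coeff v f.1) cofinite (𝓝 0) := by
  obtain ⟨f, r, hr, C, hC⟩ := f
  exact tendsto_of_weight (fun v => pow_pos (by linarith) _) (finite_pow_degree_le hr) hC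

open scoped Classical in
/-- The coefficients of a power series in `x`, as a series in `x` and `t`. -/
def inclFun (f : MvPowerSeries (Fin N) K) (m : (Fin N →₀ ℕ) × coneLattice A) : K :=
  if m.2 = 0 then MvPowerSeries.coeff m.1 f else 0

theorem inclFun_mul (f g : MvPowerSeries (Fin N) K) :
    inclFun K A (f * g) = conv (inclFun K A f) (inclFun K A g) := by
  classical
  funext ⟨v, w⟩
  rw [conv_apply]
  by_cases hw : w = 0
  · subst hw
    let ι : ((Fin N →₀ ℕ) × (Fin N →₀ ℕ)) ↪
        ((Fin N →₀ ℕ) × coneLattice A) × ((Fin N →₀ ℕ) × coneLattice A) :=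
      ⟨fun q => ((q.1, 0), (q.2, 0)), fun q q' h => by
        simp only [Prod.mk.injEq, and_true] at h
        exact Prod.ext h.1 h.2⟩
    rw [tsum_eq_sum (s := (Finset.HasAntidiagonal.antidiagonal v).map ι)]
    · rw [Finset.sum_map]
      simp only [inclFun, if_true, MvPowerSeries.coeff_mul]
      refine Finset.sum_congr rfl fun q hq => ?_
      have hq' : (q.1, (0 : coneLattice A)) + (q.2, 0) = (v, 0) := by
        rw [Prod.mk_add_mk, Finset.HasAntidiagonal.mem_antidiagonal.mp hq, add_zero]
      have hι : ι q = ((q.1, 0), (q.2, 0)) := rfl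
      rw [hι]
      simp only [if_true]
      rw [if_pos hq']
    · rintro ⟨⟨v1, w1⟩, ⟨v2, w2⟩⟩ h
      by_cases h1 : w1 = 0
      · by_cases h2 : w2 = 0
        · subst h1 h2
          rw [if_neg]
          intro h3
          apply h
          simp only [Prod.mk_add_mk, Prod.mk.injEq] at h3
          exact Finset.mem_map.mpr ⟨(v1, v2), Finset.HasAntidiagonal.mem_antidiagonal.mpr h3.1, rfl⟩
        · simp [inclFun, h2]
      · simp [inclFun, h1]
  · rw [inclFun, if_neg hw, eq_comm]
    convert tsum_zero with q
    by_cases h1 : q.1.2 = 0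
    · by_cases h2 : q.2.2 = 0
      · rw [if_neg]
        intro h3
        apply hw
        have h4 := congrArg Prod.snd h3
        rw [Prod.snd_add, h1, h2, add_zero] at h4
        exact h4.symm
      · simp [inclFun, h2]
    · simp [inclFun, h1]

theorem inclFun_bounded (f : OverconvergentSeries p K N) : ∃ r : ℝ, 1 < r ∧ ∃ s : ℝ, 1 < s ∧
    ∃ C : ℝ, ∀ (v : Fin N →₀ ℕ) (w : coneLattice A),
      ‖inclFun K A f.1 (v, w)‖ * (r ^ v.degree * s ^ latticeDeg A w) ≤ C := by
  classical
  obtain ⟨f, r, hr, C, hC⟩ := f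
  refine ⟨r, hr, 2, one_lt_two, C, fun v w => ?_⟩
  by_cases hw : w = 0
  · subst hw
    simpa [inclFun, latticeDeg_zero] using hC v
  · have h0 : 0 ≤ C := le_trans (by have : 0 < r := by linarith
                                    positivity) (hC v)
    simpa [inclFun, hw] using h0

variable [FiniteDimensional ℚ_[p] K]

/-- The algebra `L†` of the series `∑ a_{vw} x^v t^w`, `v ∈ ℕ^N`, `w ∈ ℤⁿ ∩ δ`, such that
`|a_{vw}| r^{|v|} s^{d(w)}` is bounded for some `r > 1` and `s > 1`.  Such a family of coefficients
is automatically null, see `tendsto_of_bounded_weight`. -/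
def Ldagger : Subalgebra K (nullFam p K ((Fin N →₀ ℕ) × coneLattice A)) where
  carrier := {f | ∃ r : ℝ, 1 < r ∧ ∃ s : ℝ, 1 < s ∧ ∃ C : ℝ,
    ∀ (v : Fin N →₀ ℕ) (w : coneLattice A),
      ‖f.1 (v, w)‖ * (r ^ v.degree * s ^ latticeDeg A w) ≤ C}
  mul_mem' := by
    rintro f g ⟨r, hr, s, hs, C, hC⟩ ⟨r', hr', s', hs', D, hD⟩
    have := isUltrametricDist p K
    have h1 : 1 < min r r' := lt_min hr hr'
    have h2 : 1 < min s s' := lt_min hs hs'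
    refine ⟨min r r', h1, min s s', h2, C * D, fun v w => ?_⟩
    exact conv_norm_le (ρ := weight A (min r r') (min s s')) (weight_pos A h1 h2)
      (weight_add_le A h1 h2)
      (fun m => (mul_le_mul_of_nonneg_left
        (weight_mono A h1 h2 (min_le_left _ _) (min_le_left _ _) m) (norm_nonneg _)).trans
          (hC m.1 m.2))
      (fun m => (mul_le_mul_of_nonneg_left
        (weight_mono A h1 h2 (min_le_right _ _) (min_le_right _ _) m) (norm_nonneg _)).trans
          (hD m.1 m.2)) (v, w)
  add_mem' := by
    rintro f g ⟨r, hr, s, hs, C, hC⟩ ⟨r', hr', s', hs', D, hD⟩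
    have h1 : 1 < min r r' := lt_min hr hr'
    have h2 : 1 < min s s' := lt_min hs hs'
    refine ⟨min r r', h1, min s s', h2, C + D, fun v w => ?_⟩
    exact add_norm_le (f := f.1) (g := g.1) (ρ := weight A (min r r') (min s s'))
      (weight_pos A h1 h2)
      (fun m => (mul_le_mul_of_nonneg_left
        (weight_mono A h1 h2 (min_le_left _ _) (min_le_left _ _) m) (norm_nonneg _)).trans
          (hC m.1 m.2))
      (fun m => (mul_le_mul_of_nonneg_left
        (weight_mono A h1 h2 (min_le_right _ _) (min_le_right _ _) m) (norm_nonneg _)).trans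
          (hD m.1 m.2)) (v, w)
  algebraMap_mem' := fun c => ⟨2, one_lt_two, 2, one_lt_two, ‖c‖, fun v w =>
    algebraMap_norm_le c (ρ := weight A 2 2) (weight_zero A 2 2) (v, w)⟩

/-- The algebra `L₀†` of the series `∑ a_w t^w`, `w ∈ ℤⁿ ∩ δ`, such that `|a_w| s^{d(w)}` is bounded
for some `s > 1`.  Such a family of coefficients is automatically null, see
`tendsto_of_bounded_rpow`. -/
def LdaggerZero : Subalgebra K (nullFam p K (coneLattice A)) where
  carrier := {f | ∃ s : ℝ, 1 < s ∧ ∃ C : ℝ, ∀ w : coneLattice A,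
    ‖f.1 w‖ * s ^ latticeDeg A w ≤ C}
  mul_mem' := by
    rintro f g ⟨s, hs, C, hC⟩ ⟨s', hs', D, hD⟩
    have := isUltrametricDist p K
    have h2 : 1 < min s s' := lt_min hs hs'
    have h0 : 0 < min s s' := by linarith
    refine ⟨min s s', h2, C * D, fun w => ?_⟩
    exact conv_norm_le (ρ := fun w => min s s' ^ latticeDeg A w) (fun w => Real.rpow_pos_of_pos h0 _)
      (rpow_latticeDeg_add_le A h2)
      (fun w => (mul_le_mul_of_nonneg_left (Real.rpow_le_rpow h0.le (min_le_left _ _)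
        (latticeDeg_nonneg A w)) (norm_nonneg _)).trans (hC w))
      (fun w => (mul_le_mul_of_nonneg_left (Real.rpow_le_rpow h0.le (min_le_right _ _)
        (latticeDeg_nonneg A w)) (norm_nonneg _)).trans (hD w)) w
  add_mem' := by
    rintro f g ⟨s, hs, C, hC⟩ ⟨s', hs', D, hD⟩
    have h2 : 1 < min s s' := lt_min hs hs'
    have h0 : 0 < min s s' := by linarith
    refine ⟨min s s', h2, C + D, fun w => ?_⟩
    exact add_norm_le (f := f.1) (g := g.1) (ρ := fun w => min s s' ^ latticeDeg A w)
      (fun w => Real.rpow_pos_of_pos h0 _)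
      (fun w => (mul_le_mul_of_nonneg_left (Real.rpow_le_rpow h0.le (min_le_left _ _)
        (latticeDeg_nonneg A w)) (norm_nonneg _)).trans (hC w))
      (fun w => (mul_le_mul_of_nonneg_left (Real.rpow_le_rpow h0.le (min_le_right _ _)
        (latticeDeg_nonneg A w)) (norm_nonneg _)).trans (hD w)) w
  algebraMap_mem' := fun c => ⟨2, one_lt_two, ‖c‖, fun w =>
    algebraMap_norm_le c (ρ := fun w => 2 ^ latticeDeg A w) (by simp [latticeDeg_zero]) w⟩

/-! ### `L†` as a `K⟨x⟩†`-algebra -/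

/-- The inclusion `K⟨x⟩† → L†`. -/
def incl : OverconvergentSeries p K N →+* Ldagger p K A where
  toFun f := ⟨⟨inclFun K A f.1, by
    obtain ⟨r, hr, s, hs, C, hC⟩ := inclFun_bounded p K A f
    exact tendsto_of_bounded_weight p K A hr hs hC⟩, inclFun_bounded p K A f⟩
  map_one' := by
    classical
    refine Subtype.ext (Subtype.ext (funext fun ⟨v, w⟩ => ?_))
    change inclFun K A 1 (v, w) = (1 : nullFam p K ((Fin N →₀ ℕ) × coneLattice A)).1 (v, w)
    rw [coe_one_apply, inclFun, MvPowerSeries.coeff_one]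
    by_cases hv : v = 0 <;> by_cases hw : w = 0 <;> simp [hv, hw, Prod.ext_iff]
  map_mul' f g := Subtype.ext (Subtype.ext (inclFun_mul K A f.1 g.1))
  map_zero' := by
    refine Subtype.ext (Subtype.ext (funext fun m => ?_))
    change inclFun K A 0 m = 0
    simp [inclFun]
  map_add' f g := by
    refine Subtype.ext (Subtype.ext (funext fun m => ?_))
    change inclFun K A (f.1 + g.1) m = inclFun K A f.1 m + inclFun K A g.1 m
    by_cases hm : m.2 = 0 <;> simp [inclFun, hm]

instance : Algebra (OverconvergentSeries p K N) (Ldagger p K A) := (incl p K A).toAlgebra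

/-! ### Evaluation at a point of the closed unit polydisc -/

end Rings

section Eval

variable (p : ℕ) [Fact p.Prime] (K : Type*) [NormedField K] [NormedAlgebra ℚ_[p] K] {N : ℕ}
  (K' : Type*) [NormedField K'] [NormedAlgebra ℚ_[p] K'] [FiniteDimensional ℚ_[p] K']
  [NormedAlgebra K K']

theorem norm_monomial_le {a : Fin N → K'} (ha : ∀ i, ‖a i‖ ≤ 1) (v : Fin N →₀ ℕ) :
    ‖∏ i, a i ^ v i‖ ≤ 1 := by
  rw [norm_prod]
  exact Finset.prod_le_one (fun _ _ => norm_nonneg _) fun i _ => by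
    rw [norm_pow]; exact pow_le_one₀ (norm_nonneg _) (ha i)

theorem summable_eval (a : Fin N → K') (ha : ∀ i, ‖a i‖ ≤ 1) (f : OverconvergentSeries p K N) :
    Summable fun v => algebraMap K K' (MvPowerSeries.coeff v f.1) * ∏ i, a i ^ v i := by
  have := isUltrametricDist p K'
  have := completeSpace p K'
  refine summable_of_tendsto (squeeze_zero_norm (fun v => ?_)
    (tendsto_norm_zero.comp (OverconvergentSeries.tendsto p K f)))
  rw [norm_mul, norm_algebraMap']
  exact mul_le_of_le_one_right (norm_nonneg _) (norm_monomial_le K' ha v)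

theorem tsum_mul_tsum_antidiagonal {L : Type*} [NormedField L] [IsUltrametricDist L]
    [CompleteSpace L] {F G : (Fin N →₀ ℕ) → L} (hF : Summable F) (hG : Summable G) :
    (∑' v, F v) * ∑' v, G v =
      ∑' v, ∑ q ∈ Finset.HasAntidiagonal.antidiagonal v, F q.1 * G q.2 := by
  have : NonarchimedeanRing L := ⟨NonarchimedeanAddGroup.is_nonarchimedean⟩
  exact hF.tsum_mul_tsum_eq_tsum_sum_antidiagonal hG (hF.mul_of_nonarchimedean hG)

theorem eval_mul (a : Fin N → K') (ha : ∀ i, ‖a i‖ ≤ 1) (f g : OverconvergentSeries p K N) :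
    ∑' v, algebraMap K K' (MvPowerSeries.coeff v (f.1 * g.1)) * ∏ i, a i ^ v i =
      (∑' v, algebraMap K K' (MvPowerSeries.coeff v f.1) * ∏ i, a i ^ v i) *
        ∑' v, algebraMap K K' (MvPowerSeries.coeff v g.1) * ∏ i, a i ^ v i := by
  classical
  have := isUltrametricDist p K'
  have := completeSpace p K'
  have hf := summable_eval p K K' a ha f
  have hg := summable_eval p K K' a ha g
  refine Eq.trans (tsum_congr fun v => ?_) (tsum_mul_tsum_antidiagonal hf hg).symm
  rw [MvPowerSeries.coeff_mul, map_sum, Finset.sum_mul]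
  refine Finset.sum_congr rfl fun q hq => ?_
  rw [← Finset.HasAntidiagonal.mem_antidiagonal.mp hq, map_mul]
  simp only [Finsupp.add_apply, pow_add, Finset.prod_mul_distrib]
  ring

/-- The homomorphism `K⟨x⟩† → K'`, `f ↦ f(a)`, that sends `x_i` to `a_i`, for a point `a` of the
closed unit polydisc. -/
def evalHom (a : Fin N → K') (ha : ∀ i, ‖a i‖ ≤ 1) : OverconvergentSeries p K N →+* K' where
  toFun f := ∑' v, algebraMap K K' (MvPowerSeries.coeff v f.1) * ∏ i, a i ^ v i
  map_one' := by
    classical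
    rw [tsum_eq_single 0 fun v hv => by
      rw [OneMemClass.coe_one, MvPowerSeries.coeff_one, if_neg hv, map_zero, zero_mul]]
    simp
  map_zero' := by simp
  map_add' f g := by
    rw [← (summable_eval p K K' a ha f).tsum_add (summable_eval p K K' a ha g)]
    refine tsum_congr fun v => ?_
    change algebraMap K K' (MvPowerSeries.coeff v (f.1 + g.1)) * _ = _
    rw [map_add, map_add, add_mul]
  map_mul' f g := eval_mul p K K' a ha f g

end Eval

end GKZ

end

/-! Write R for K⟨x⟩†. A member of L† is a family of coefficients f_w in R whose norms at a common
radius r > 1 decay like s^{-d(w)}. Flatness and injectivity of the specialization both follow from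
one statement, `exists_eq_sum_of_slice_mem`: if M is a submodule of R^l and every coefficient of a
tuple over L† lies in M, then the tuple is a combination, with coefficients in L†, of finitely many
members of M.

The point is to write each coefficient as a combination of the same finite family in M with
quotients bounded uniformly relative to the coefficient, so that the quotients again assemble into
series of L†. This is division by a standard basis. Shrink r so that the norms of nonzero elements
of K are powers of r (`exists_discrete_radius`); the nonzero values |a_v| r^{|v|} then lie in r^ℤ.
The leading position of a tuple is the last one at which the maximal value occurs, and Dickson's
lemma gives finitely many members of M whose leading positions divide all others. Cancelling leading
terms terminates by well-foundedness of the position order, and discreteness then lowers the maximal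
value by a full factor r (`IsStandardBasis.exists_approx_of_lt`). Iterating, the remainders tend to
zero and the quotients converge, so division on M is exact (`IsStandardBasis.exists_eq_sum`).

For flatness, a relation ∑ f_i g_i = 0 with g_i in L† holds coefficient by coefficient; taking M to
be the relations among the f_i gives the equational criterion. For injectivity, write a tensor as ∑
e_i ⊗ f_i with e a basis of K' over K, and take M to be the kernel of y ↦ ∑ y_i(a) e_i. Surjectivity
is elementary: the coordinates of a series of L₀† in the basis e lift to series constant in x. -/

noncomputable section

namespace GKZ

/-! ### Discreteness of the value group -/

section Discrete

/-- A finite extension of `ℚ_p` has a uniformizer. -/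
theorem exists_uniformizer (p : ℕ) [Fact p.Prime] (K : Type*) [NormedField K]
    [NormedAlgebra ℚ_[p] K] [FiniteDimensional ℚ_[p] K] :
    ∃ ϖ : K, 0 < ‖ϖ‖ ∧ ‖ϖ‖ < 1 ∧ ∀ c : K, c ≠ 0 → ∃ n : ℤ, ‖c‖ = ‖ϖ‖ ^ n := by
  have := isUltrametricDist p K
  have : ProperSpace K := FiniteDimensional.proper ℚ_[p] K
  -- The open unit ball is closed because the norm is ultrametric, hence compact. A point of maximal
  -- norm in it leaves no norms strictly between `‖ϖ‖` and 1; it is nonzero because p lies in the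
  -- ball.
  have hcomp : IsCompact (Metric.ball (0 : K) 1) :=
    Metric.isCompact_of_isClosed_isBounded (IsUltrametricDist.isClosed_ball _ _)
      Metric.isBounded_ball
  obtain ⟨ϖ, hϖ, hmax⟩ := hcomp.exists_isMaxOn ⟨0, by simp⟩ (continuous_norm (E := K)).continuousOn
  have h1 : ‖ϖ‖ < 1 := by simpa using hϖ
  have hmax' : ∀ c : K, ‖c‖ < 1 → ‖c‖ ≤ ‖ϖ‖ := fun c hc => hmax (by simpa using hc)
  have h0 : 0 < ‖ϖ‖ := by
    have hp := norm_algebraMap' K (p : ℚ_[p])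
    have hp1 : ‖(p : ℚ_[p])‖ < 1 := Padic.norm_p_lt_one
    have hp0 : 0 < ‖(p : ℚ_[p])‖ := norm_pos_iff.mpr (by
      exact_mod_cast (Fact.out : p.Prime).ne_zero)
    exact (hp ▸ hp0).trans_le (hmax' _ (hp ▸ hp1))
  refine ⟨ϖ, h0, h1, fun c hc => ?_⟩
  have hinv : 1 < ‖ϖ‖⁻¹ := (one_lt_inv₀ h0).mpr h1
  -- This n puts the norm of `c * ϖ ^ (n + 1)` into the interval (‖ϖ‖, 1], where the only possible
  -- norm is 1.
  obtain ⟨n, hn, hn'⟩ := exists_mem_Ioc_zpow (norm_pos_iff.mpr hc) hinv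
  refine ⟨-(n + 1), ?_⟩
  have hle : ‖c * ϖ ^ (n + 1)‖ ≤ 1 := by
    rw [norm_mul, norm_zpow]
    rw [inv_zpow] at hn'
    calc _ ≤ (‖ϖ‖ ^ (n + 1))⁻¹ * ‖ϖ‖ ^ (n + 1) := by gcongr
      _ = 1 := inv_mul_cancel₀ (zpow_pos h0 _).ne'
  have hlt : ‖ϖ‖ < ‖c * ϖ ^ (n + 1)‖ := by
    rw [norm_mul, norm_zpow]
    rw [inv_zpow] at hn
    calc ‖ϖ‖ = (‖ϖ‖ ^ n)⁻¹ * ‖ϖ‖ ^ (n + 1) := by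
          rw [zpow_add_one₀ h0.ne', inv_mul_cancel_left₀ (zpow_pos h0 _).ne']
      _ < _ := by have := zpow_pos h0 (n + 1); gcongr
  have heq : ‖c * ϖ ^ (n + 1)‖ = 1 := by
    by_contra hne
    exact absurd (hmax' _ (lt_of_le_of_ne hle hne)) (not_le.mpr hlt)
  rw [norm_mul, norm_zpow] at heq
  rw [zpow_neg]
  exact eq_inv_of_mul_eq_one_left heq

/-- There are radii `r > 1`, arbitrarily close to `1`, such that all norms of nonzero elements
are integral powers of `r`. -/
theorem exists_discrete_radius (p : ℕ) [Fact p.Prime] (K : Type*) [NormedField K]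
    [NormedAlgebra ℚ_[p] K] [FiniteDimensional ℚ_[p] K] {r₀ : ℝ} (hr₀ : 1 < r₀) :
    ∃ r : ℝ, 1 < r ∧ r < r₀ ∧ ∀ c : K, c ≠ 0 → ∃ n : ℤ, ‖c‖ = r ^ n := by
  obtain ⟨ϖ, h0, h1, hϖ⟩ := exists_uniformizer p K
  have hinv : 1 < ‖ϖ‖⁻¹ := (one_lt_inv₀ h0).mpr h1
  obtain ⟨m, hm⟩ := pow_unbounded_of_one_lt ‖ϖ‖⁻¹ hr₀
  have hm0 : m ≠ 0 := by
    rintro rfl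
    rw [pow_zero] at hm
    linarith
  have hr0 : (0 : ℝ) ≤ ‖ϖ‖⁻¹ := by positivity
  have hpow : (‖ϖ‖⁻¹ ^ ((m : ℝ)⁻¹)) ^ m = ‖ϖ‖⁻¹ := Real.rpow_inv_natCast_pow hr0 hm0
  -- The m-th root of `‖ϖ‖⁻¹` tends to 1 as m grows, and powers of `‖ϖ‖` remain integral powers of
  -- it.
  refine ⟨‖ϖ‖⁻¹ ^ ((m : ℝ)⁻¹), Real.one_lt_rpow hinv (by positivity), ?_, fun c hc => ?_⟩
  · refine lt_of_pow_lt_pow_left₀ m (by linarith) ?_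
    rw [hpow]
    exact hm
  · obtain ⟨n, hn⟩ := hϖ c hc
    refine ⟨m * -n, ?_⟩
    rw [zpow_mul, zpow_natCast, hpow, hn, inv_zpow, zpow_neg, inv_inv]

end Discrete

/-! ### Tuples of overconvergent series and their leading positions -/

section Tuples

variable {p : ℕ} [Fact p.Prime] {K : Type*} [NormedField K] [NormedAlgebra ℚ_[p] K]
  {l N : ℕ}

/-- The weighted absolute values `|a_v| r^{|v|}` of the coefficients of a tuple of series. -/
def wcoeff (r : ℝ) (g : Fin l → OverconvergentSeries p K N) (x : Fin l × (Fin N →₀ ℕ)) : ℝ :=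
  ‖MvPowerSeries.coeff x.2 (g x.1).1‖ * r ^ x.2.degree

/-- A tuple of series whose members satisfy `|a_v| r^{|v|} → 0`. -/
def IsRestrictedTuple (r : ℝ) (g : Fin l → OverconvergentSeries p K N) : Prop :=
  ∀ i, MvPowerSeries.IsRestricted (fun _ => r) (g i).1

/-- The positions of the coefficients of a tuple are ordered with priority to the exponent. -/
def positionOrder (x : Fin l × (Fin N →₀ ℕ)) :
    Lex ((MonomialOrder.lex (σ := Fin N)).syn × Fin l) :=
  toLex (MonomialOrder.lex.toSyn x.2, x.1)

/-- `x` is the last position of the tuple `g` at which the weighted absolute value attains its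
maximum `B`. -/
structure IsLead (r : ℝ) (g : Fin l → OverconvergentSeries p K N) (x : Fin l × (Fin N →₀ ℕ))
    (B : ℝ) : Prop where
  pos : 0 < B
  le : ∀ x', wcoeff r g x' ≤ B
  eq : wcoeff r g x = B
  lt : ∀ x', positionOrder x < positionOrder x' → wcoeff r g x' < B

theorem positionOrder_injective : Function.Injective (positionOrder (l := l) (N := N)) := by
  rintro ⟨i, v⟩ ⟨i', v'⟩ h
  have h' := congrArg ofLex h
  simp only [positionOrder, ofLex_toLex, Prod.mk.injEq, EmbeddingLike.apply_eq_iff_eq] at h'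
  exact Prod.ext h'.2 h'.1

/-- Compatibility with translation: multiplying a tuple by a monomial shifts its leading position by
the exponent of that monomial. -/
theorem positionOrder_add_lt {i i' : Fin l} {v v' : Fin N →₀ ℕ} (u : Fin N →₀ ℕ) :
    positionOrder (i, v + u) < positionOrder (i', v' + u) ↔
      positionOrder (i, v) < positionOrder (i', v') := by
  simp [positionOrder, Prod.Lex.toLex_lt_toLex]

theorem prod_const_pow (r : ℝ) (v : Fin N →₀ ℕ) : v.prod (fun _ k => r ^ k) = r ^ v.degree := by
  rw [Finsupp.prod, Finset.prod_pow_eq_pow_sum, Finsupp.degree_apply]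

/-- Passing to a smaller radius gains the factor (r/r')^{|v|}, which tends to zero. -/
theorem isRestricted_of_bounded {K : Type*} [NormedField K] {f : MvPowerSeries (Fin N) K}
    {r r' C : ℝ} (hr : 0 < r) (hr' : r < r')
    (hf : ∀ v, ‖MvPowerSeries.coeff v f‖ * r' ^ v.degree ≤ C) :
    MvPowerSeries.IsRestricted (fun _ => r) f := by
  have h1 : 1 < r' / r := (one_lt_div hr).mpr hr'
  refine tendsto_of_weight (K := ℝ) (ρ := fun v : Fin N →₀ ℕ => (r' / r) ^ v.degree) (C := C)
    (fun v => by positivity) (finite_pow_degree_le h1) fun v => ?_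
  rw [prod_const_pow, Real.norm_of_nonneg (by positivity), mul_assoc, ← mul_pow,
    mul_div_cancel₀ _ hr.ne']
  exact hf v

/-- Values tending to zero are at least B only finitely often; this is what makes a last maximal
position exist. -/
theorem IsRestrictedTuple.finite {r : ℝ} {g : Fin l → OverconvergentSeries p K N}
    (hg : IsRestrictedTuple r g) {B : ℝ} (hB : 0 < B) : {x | wcoeff r g x = B}.Finite := by
  have h : ∀ i, {v | wcoeff r g (i, v) = B}.Finite := fun i => by
    have := (hg i).eventually (gt_mem_nhds hB)
    rw [eventually_cofinite] at this
    refine this.subset fun v hv => ?_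
    have hv' : wcoeff r g (i, v) = B := hv
    rw [Set.mem_ofPred_eq, prod_const_pow, not_lt]
    exact hv'.ge
  refine (Set.finite_iUnion fun i => (h i).image (Prod.mk i)).subset ?_
  rintro ⟨i, v⟩ hx
  exact Set.mem_iUnion.mpr ⟨i, v, hx, rfl⟩

theorem IsRestrictedTuple.exists_isLead {r : ℝ} {g : Fin l → OverconvergentSeries p K N}
    (hg : IsRestrictedTuple r g) {B : ℝ} (hB : 0 < B) (hle : ∀ x, wcoeff r g x ≤ B)
    (hne : ∃ x, wcoeff r g x = B) : ∃ x, IsLead r g x B := by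
  obtain ⟨x, hx, hmax⟩ := Set.exists_max_image _ positionOrder (hg.finite hB) hne
  exact ⟨x, hB, hle, hx, fun x' hx' => lt_of_le_of_ne (hle x') fun h =>
    absurd (hmax x' h) (not_le.mpr hx')⟩

/-- A form of Dickson's lemma. -/
theorem exists_finite_generating_positions (S : Set (Fin l × (Fin N →₀ ℕ))) :
    ∃ (k : ℕ) (x : Fin k → Fin l × (Fin N →₀ ℕ)), (∀ j, x j ∈ S) ∧
      ∀ y ∈ S, ∃ j, (x j).1 = y.1 ∧ (x j).2 ≤ y.2 := by
  -- The minimal exponents of each component form an antichain in the well-quasi-order ℕ^N, so there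
  -- are finitely many, and every exponent dominates one of them.
  let T : Fin l → Set (Fin N →₀ ℕ) := fun i => {v | Minimal (fun v => (i, v) ∈ S) v}
  have hT : ∀ i, (T i).Finite := fun i =>
    WellQuasiOrderedLE.finite_of_isAntichain (setOfPred_minimal_antichain _)
  have hF : (⋃ i, Prod.mk i '' T i).Finite := Set.finite_iUnion fun i => (hT i).image _
  obtain ⟨k, x, -, hx⟩ := hF.fin_param
  have hmem : ∀ y, (∃ j, x j = y) ↔ ∃ i, ∃ v ∈ T i, (i, v) = y := fun y => by
    rw [← Set.mem_range, hx, Set.mem_iUnion]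
    rfl
  refine ⟨k, x, fun j => ?_, fun ⟨i, v⟩ hy => ?_⟩
  · obtain ⟨i, v, hv, h⟩ := (hmem (x j)).mp ⟨j, rfl⟩
    have hv' : Minimal (fun v => (i, v) ∈ S) v := hv
    exact h ▸ hv'.prop
  · obtain ⟨b, hb, hmin⟩ := (Set.isPWO_of_wellQuasiOrderedLE {v | (i, v) ∈ S}).exists_le_minimal hy
    obtain ⟨j, hj⟩ := (hmem (i, b)).mpr ⟨i, b, hmin, rfl⟩
    exact ⟨j, by rw [hj], by rw [hj]; exact hb⟩

end Tuples

/-! ### Division by a standard basis -/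

section Division

variable {p : ℕ} [Fact p.Prime] {K : Type*} [NormedField K] [NormedAlgebra ℚ_[p] K]
  {l N : ℕ}

variable (p) in
/-- The monomial `c x^u`. -/
def monomialSeries (u : Fin N →₀ ℕ) (c : K) : OverconvergentSeries p K N :=
  ⟨MvPowerSeries.monomial u c, 2, one_lt_two, ‖c‖ * 2 ^ u.degree, fun v => by
    classical
    rw [MvPowerSeries.coeff_monomial]
    split_ifs with h
    · rw [h]
    · rw [norm_zero, zero_mul]
      positivity⟩

theorem wcoeff_monomial_smul_of_le {r : ℝ} (g : Fin l → OverconvergentSeries p K N) (i : Fin l)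
    (u v : Fin N →₀ ℕ) (c : K) :
    wcoeff r (monomialSeries p u c • g) (i, v + u) = ‖c‖ * r ^ u.degree * wcoeff r g (i, v) := by
  change ‖MvPowerSeries.coeff (v + u) (MvPowerSeries.monomial u c * (g i).1)‖ * _ = _
  rw [add_comm v u, MvPowerSeries.coeff_add_monomial_mul, norm_mul, map_add, pow_add, wcoeff]
  ring

theorem wcoeff_monomial_smul_of_not_le {r : ℝ} (g : Fin l → OverconvergentSeries p K N)
    (i : Fin l) {u v : Fin N →₀ ℕ} (c : K) (h : ¬ u ≤ v) :
    wcoeff r (monomialSeries p u c • g) (i, v) = 0 := by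
  classical
  change ‖MvPowerSeries.coeff v (MvPowerSeries.monomial u c * (g i).1)‖ * _ = _
  rw [MvPowerSeries.coeff_monomial_mul, if_neg h, norm_zero, zero_mul]

theorem wcoeff_sub_le {r : ℝ} (hr : 0 ≤ r) (f g : Fin l → OverconvergentSeries p K N)
    (x : Fin l × (Fin N →₀ ℕ)) : wcoeff r (f - g) x ≤ max (wcoeff r f x) (wcoeff r g x) := by
  have := isUltrametricDist p K
  unfold wcoeff
  rw [← max_mul_of_nonneg _ _ (by positivity)]
  refine mul_le_mul_of_nonneg_right ?_ (by positivity)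
  change ‖MvPowerSeries.coeff x.2 ((f x.1).1 - (g x.1).1)‖ ≤ _
  rw [map_sub]
  exact (sub_eq_add_neg (MvPowerSeries.coeff x.2 (f x.1).1) _ ▸ IsUltrametricDist.norm_add_le_max _ _).trans
    (by rw [norm_neg])

theorem IsRestrictedTuple.sub {r : ℝ} {f g : Fin l → OverconvergentSeries p K N}
    (hf : IsRestrictedTuple r f) (hg : IsRestrictedTuple r g) : IsRestrictedTuple r (f - g) :=
  fun i => by
    change MvPowerSeries.IsRestricted _ ((f i).1 - (g i).1)
    rw [sub_eq_add_neg]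
    exact MvPowerSeries.isRestricted.add _ (hf i) (MvPowerSeries.isRestricted.neg _ (hg i))

theorem IsRestrictedTuple.monomial_smul {r : ℝ} {g : Fin l → OverconvergentSeries p K N}
    (hg : IsRestrictedTuple r g) (u : Fin N →₀ ℕ) (c : K) :
    IsRestrictedTuple r (monomialSeries p u c • g) := fun i => by
  have := isUltrametricDist p K
  exact MvPowerSeries.isRestricted.mul _ (MvPowerSeries.isRestricted_monomial _ u c) (hg i)

/-- Nonzero weighted values are integral powers of r, so a strict inequality gains a whole factor r.
This is the source of geometric convergence in the division. -/
theorem wcoeff_le_of_lt {r : ℝ} (hr : 1 < r) (hK : ∀ c : K, c ≠ 0 → ∃ n : ℤ, ‖c‖ = r ^ n)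
    {g : Fin l → OverconvergentSeries p K N} {x : Fin l × (Fin N →₀ ℕ)} {n : ℤ}
    (h : wcoeff r g x < r ^ n) : wcoeff r g x ≤ r ^ (n - 1) := by
  have hr0 : 0 < r := by linarith
  unfold wcoeff at h ⊢
  by_cases h0 : MvPowerSeries.coeff x.2 (g x.1).1 = 0
  · rw [h0, norm_zero, zero_mul]
    positivity
  · obtain ⟨m, hm⟩ := hK _ h0
    rw [hm, ← zpow_natCast, ← zpow_add₀ hr0.ne'] at h ⊢
    have := (zpow_lt_zpow_iff_right₀ hr).mp h
    exact zpow_le_zpow_right₀ hr.le (by omega)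

/-- Cancellation of the leading term of `g` by a monomial multiple of `y`. -/
theorem IsLead.exists_reduction {r : ℝ} (hr : 0 < r) {g y : Fin l → OverconvergentSeries p K N}
    {i : Fin l} {v v' : Fin N →₀ ℕ} {B B' : ℝ} (hg : IsLead r g (i, v) B)
    (hy : IsLead r y (i, v') B') (hle : v' ≤ v) :
    ∃ (u : Fin N →₀ ℕ) (c : K), ‖c‖ * r ^ u.degree * B' = B ∧
      ∀ x, wcoeff r (g - monomialSeries p u c • y) x ≤ B ∧
        (positionOrder (i, v) ≤ positionOrder x →
          wcoeff r (g - monomialSeries p u c • y) x < B) := by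
  obtain ⟨u, rfl⟩ := exists_add_of_le hle
  set a := MvPowerSeries.coeff (v' + u) (g i).1 with ha
  set b := MvPowerSeries.coeff v' (y i).1 with hb
  have hgB : ‖a‖ * r ^ (v' + u).degree = B := hg.eq
  have hyB : ‖b‖ * r ^ v'.degree = B' := hy.eq
  have hb0 : b ≠ 0 := by
    intro h
    rw [h, norm_zero, zero_mul] at hyB
    exact hy.pos.ne hyB
  have hc : ‖a / b‖ * r ^ u.degree * B' = B := by
    have hb' : ‖b‖ ≠ 0 := norm_ne_zero_iff.mpr hb0
    rw [← hgB, ← hyB, norm_div, map_add, pow_add]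
    field_simp
  have hc0 : 0 < ‖a / b‖ * r ^ u.degree :=
    pos_of_mul_pos_left (hc ▸ hg.pos) hy.pos.le
  -- The multiple of y has maximal value exactly B, attained last at the leading position of g. The
  -- leading terms cancel there, and both tuples are strictly below B at later positions; earlier
  -- positions may still have value B.
  have hle' : ∀ x, wcoeff r (monomialSeries p u (a / b) • y) x ≤ B := by
    rintro ⟨i', w⟩
    by_cases hw : u ≤ w
    · obtain ⟨w, rfl⟩ := exists_add_of_le hw
      rw [add_comm, wcoeff_monomial_smul_of_le, ← hc]
      exact mul_le_mul_of_nonneg_left (hy.le _) hc0.le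
    · rw [wcoeff_monomial_smul_of_not_le _ _ _ hw]
      exact hg.pos.le
  refine ⟨u, a / b, hc, fun x => ⟨?_, fun hx => ?_⟩⟩
  · exact (wcoeff_sub_le hr.le _ _ _).trans (max_le (hg.le x) (hle' x))
  · rcases hx.eq_or_lt with h | h
    · rw [← positionOrder_injective h]
      have h0 : MvPowerSeries.coeff (v' + u)
          ((g i).1 - MvPowerSeries.monomial u (a / b) * (y i).1) = 0 := by
        rw [map_sub, add_comm v' u, MvPowerSeries.coeff_add_monomial_mul, ← hb, add_comm u v', ← ha,
          div_mul_cancel₀ _ hb0, sub_self]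
      have h1 : wcoeff r (g - monomialSeries p u (a / b) • y) (i, v' + u) = 0 := by
        change ‖MvPowerSeries.coeff (v' + u)
          ((g i).1 - MvPowerSeries.monomial u (a / b) * (y i).1)‖ * _ = 0
        rw [h0, norm_zero, zero_mul]
      rw [h1]
      exact hg.pos
    · refine (wcoeff_sub_le hr.le _ _ _).trans_lt (max_lt (hg.lt x h) ?_)
      obtain ⟨i', w⟩ := x
      by_cases hw : u ≤ w
      · obtain ⟨w, rfl⟩ := exists_add_of_le hw
        rw [add_comm u w] at h ⊢
        rw [wcoeff_monomial_smul_of_le, ← hc]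
        exact mul_lt_mul_of_pos_left (hy.lt _ ((positionOrder_add_lt u).mp h)) hc0
      · rw [wcoeff_monomial_smul_of_not_le _ _ _ hw]
        exact hg.pos

/-- A standard basis of the restricted part of `M` for the radius `r`: finitely many members of
`M` whose leading positions divide those of all members of `M`. -/
structure IsStandardBasis (r : ℝ) (M : Submodule (OverconvergentSeries p K N)
    (Fin l → OverconvergentSeries p K N)) {k : ℕ}
    (y : Fin k → Fin l → OverconvergentSeries p K N) (x : Fin k → Fin l × (Fin N →₀ ℕ))
    (B : Fin k → ℝ) : Prop where
  mem : ∀ j, y j ∈ M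
  restricted : ∀ j, IsRestrictedTuple r (y j)
  isLead : ∀ j, IsLead r (y j) (x j) (B j)
  exists_le : ∀ g ∈ M, IsRestrictedTuple r g → ∀ z C, IsLead r g z C →
    ∃ j, (x j).1 = z.1 ∧ (x j).2 ≤ z.2

/-- Dickson's lemma is applied to the set of leading positions of the restricted members of M, so no
finite generation of M is assumed. -/
theorem exists_isStandardBasis (r : ℝ) (M : Submodule (OverconvergentSeries p K N)
    (Fin l → OverconvergentSeries p K N)) : ∃ (k : ℕ)
    (y : Fin k → Fin l → OverconvergentSeries p K N) (x : Fin k → Fin l × (Fin N →₀ ℕ))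
    (B : Fin k → ℝ), IsStandardBasis r M y x B := by
  obtain ⟨k, x, hx, hgen⟩ := exists_finite_generating_positions
    {x | ∃ g ∈ M, IsRestrictedTuple r g ∧ ∃ B, IsLead r g x B}
  choose y hyM hyr B hyB using hx
  exact ⟨k, y, x, B, hyM, hyr, hyB, fun g hg hgr z C hz => hgen z ⟨g, hg, hgr, C, hz⟩⟩

variable {r : ℝ} {M : Submodule (OverconvergentSeries p K N)
    (Fin l → OverconvergentSeries p K N)} {k : ℕ}
    {y : Fin k → Fin l → OverconvergentSeries p K N} {x : Fin k → Fin l × (Fin N →₀ ℕ)}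
    {B : Fin k → ℝ}

/-- One round of division, by well-founded induction on a bound P beyond which the value r^n no
longer occurs. Cancelling a leading term moves this bound down to the leading position. Once the
value r^n has disappeared, discreteness forces all values down to r^{n-1}. -/
theorem IsStandardBasis.exists_approx_of_lt (hy : IsStandardBasis r M y x B) (hr : 1 < r)
    (hK : ∀ c : K, c ≠ 0 → ∃ n : ℤ, ‖c‖ = r ^ n) (n : ℤ)
    (P : WithTop (Lex ((MonomialOrder.lex (σ := Fin N)).syn × Fin l))) :
    ∀ g ∈ M, IsRestrictedTuple r g → (∀ z, wcoeff r g z ≤ r ^ n) →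
      (∀ z, P ≤ (positionOrder z : WithTop _) → wcoeff r g z < r ^ n) →
      ∃ h : Fin k → OverconvergentSeries p K N,
        (∀ j v, ‖MvPowerSeries.coeff v (h j).1‖ * r ^ v.degree * B j ≤ r ^ n) ∧
        g - ∑ j, h j • y j ∈ M ∧ IsRestrictedTuple r (g - ∑ j, h j • y j) ∧
        ∀ z, wcoeff r (g - ∑ j, h j • y j) z ≤ r ^ (n - 1) := by
  classical
  have := isUltrametricDist p K
  have hr0 : 0 < r := by linarith
  have hn0 : 0 < r ^ n := zpow_pos hr0 n
  induction P using WellFoundedLT.induction with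
  | ind P ih =>
  intro g hgM hgr hgle hglt
  by_cases hne : ∃ z, wcoeff r g z = r ^ n
  · obtain ⟨⟨i, v⟩, hz⟩ := hgr.exists_isLead hn0 hgle hne
    obtain ⟨j, hj1, hj2⟩ := hy.exists_le g hgM hgr _ _ hz
    have hlead := hy.isLead j
    rw [show x j = (i, (x j).2) from Prod.ext hj1 rfl] at hlead
    obtain ⟨u, c, hc, hred⟩ := hz.exists_reduction hr0 hlead hj2
    have hlt : (positionOrder (i, v) : WithTop _) < P := by
      by_contra hcon
      exact (hglt _ (not_lt.mp hcon)).ne hz.eq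
    obtain ⟨h, hh, hM, hres, hbd⟩ := ih _ hlt (g - monomialSeries p u c • y j)
      (M.sub_mem hgM (M.smul_mem _ (hy.mem j)))
      (hgr.sub ((hy.restricted j).monomial_smul u c)) (fun z => (hred z).1) 
      (fun z hz' => (hred z).2 (WithTop.coe_le_coe.mp hz'))
    have hsum : g - ∑ j', (h + Pi.single j (monomialSeries p u c) :
          Fin k → OverconvergentSeries p K N) j' • y j' =
        g - monomialSeries p u c • y j - ∑ j', h j' • y j' := by
      simp only [Pi.add_apply, add_smul, Finset.sum_add_distrib]
      rw [Finset.sum_eq_single_of_mem j (Finset.mem_univ j) (f := fun j' =>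
        (Pi.single j (monomialSeries p u c) : Fin k → OverconvergentSeries p K N) j' • y j')
        (fun j' _ hj' => by rw [Pi.single_eq_of_ne hj', zero_smul]), Pi.single_eq_same]
      abel
    refine ⟨h + Pi.single j (monomialSeries p u c), fun j' v' => ?_, ?_⟩
    · by_cases hj' : j' = j
      · subst hj'
        have hB := hlead.pos
        rw [Pi.add_apply, Pi.single_eq_same]
        change ‖MvPowerSeries.coeff v' ((h j').1 + MvPowerSeries.monomial u c)‖ * _ * _ ≤ _
        rw [map_add]
        have h1 : ‖MvPowerSeries.coeff v' (MvPowerSeries.monomial u c)‖ * r ^ v'.degree * B j' ≤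
            r ^ n := by
          rw [MvPowerSeries.coeff_monomial]
          split_ifs with h
          · rw [h, hc]
          · rw [norm_zero, zero_mul, zero_mul]
            exact hn0.le
        rw [mul_assoc]
        -- By the ultrametric inequality the bound r^n survives however many monomials are added to
        -- the same quotient.
        refine (mul_le_mul_of_nonneg_right (IsUltrametricDist.norm_add_le_max _ _)
          (by positivity)).trans ?_
        rw [max_mul_of_nonneg _ _ (by positivity), ← mul_assoc, ← mul_assoc]
        exact max_le (hh j' v') h1
      · rw [Pi.add_apply, Pi.single_eq_of_ne hj', add_zero]
        exact hh j' v'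
    · rw [hsum]
      exact ⟨hM, hres, hbd⟩
  · have h0 : g - ∑ j, (0 : Fin k → OverconvergentSeries p K N) j • y j = g := by simp
    refine ⟨0, fun j v => ?_, ?_⟩
    · change ‖MvPowerSeries.coeff v (0 : MvPowerSeries (Fin N) K)‖ * _ * _ ≤ _
      rw [map_zero, norm_zero, zero_mul, zero_mul]
      exact hn0.le
    · rw [h0]
      exact ⟨hgM, hgr, fun z => wcoeff_le_of_lt hr hK
        (lt_of_le_of_ne (hgle z) fun h => hne ⟨z, h⟩)⟩

end Division

/-! ### Convergence of the division process -/

section ExactDivision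

variable {p : ℕ} [Fact p.Prime] {K : Type*} [NormedField K] [NormedAlgebra ℚ_[p] K]
  [FiniteDimensional ℚ_[p] K] {l N : ℕ} {r : ℝ} {M : Submodule (OverconvergentSeries p K N)
    (Fin l → OverconvergentSeries p K N)} {k : ℕ}
    {y : Fin k → Fin l → OverconvergentSeries p K N} {x : Fin k → Fin l × (Fin N →₀ ℕ)}
    {B : Fin k → ℝ}

/-- Division by a standard basis is exact on `M`, with bounds on the quotients. -/
theorem IsStandardBasis.exists_eq_sum (hy : IsStandardBasis r M y x B) (hr : 1 < r)
    (hK : ∀ c : K, c ≠ 0 → ∃ n : ℤ, ‖c‖ = r ^ n) (n : ℤ) (g : Fin l → OverconvergentSeries p K N)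
    (hgM : g ∈ M) (hgr : IsRestrictedTuple r g) (hgle : ∀ z, wcoeff r g z ≤ r ^ n) :
    ∃ h : Fin k → OverconvergentSeries p K N,
      (∀ j v, ‖MvPowerSeries.coeff v (h j).1‖ * r ^ v.degree * B j ≤ r ^ n) ∧
      g = ∑ j, h j • y j := by
  classical
  have := isUltrametricDist p K
  have := completeSpace p K
  have hr0 : 0 < r := by linarith
  have happrox : ∀ (n : ℤ) (g : Fin l → OverconvergentSeries p K N),
      (g ∈ M ∧ IsRestrictedTuple r g ∧ ∀ z, wcoeff r g z ≤ r ^ n) →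
      ∃ h : Fin k → OverconvergentSeries p K N,
        (∀ j v, ‖MvPowerSeries.coeff v (h j).1‖ * r ^ v.degree * B j ≤ r ^ n) ∧
        g - ∑ j, h j • y j ∈ M ∧ IsRestrictedTuple r (g - ∑ j, h j • y j) ∧
        ∀ z, wcoeff r (g - ∑ j, h j • y j) z ≤ r ^ (n - 1) := fun n g hg =>
    -- With P = ⊤ the condition on positions beyond P is vacuous.
    hy.exists_approx_of_lt hr hK n ⊤ g hg.1 hg.2.1 hg.2.2 fun z hz =>
      absurd hz (not_le.mpr (WithTop.coe_lt_top _))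
  choose! H hH using happrox
  -- The remainder after i rounds: it stays in M and has values at most r^{n-i}, so M need not be
  -- closed under limits.
  let seq : ℕ → Fin l → OverconvergentSeries p K N := fun i =>
    Nat.rec g (fun i s => s - ∑ j, H (n - i) s j • y j) i
  have hseq : ∀ i, seq (i + 1) = seq i - ∑ j, H (n - i) (seq i) j • y j := fun i => rfl
  have hgood : ∀ i : ℕ, seq i ∈ M ∧ IsRestrictedTuple r (seq i) ∧
      ∀ z, wcoeff r (seq i) z ≤ r ^ (n - i) := by
    intro i
    induction i with
    | zero => exact ⟨hgM, hgr, by simpa using! hgle⟩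
    | succ i ih =>
      have h := (hH (n - i) (seq i) ih).2
      rw [← hseq, sub_sub] at h
      exact_mod_cast h
  have hpow : Tendsto (fun i : ℕ => r ^ (n - i)) atTop (𝓝 0) := by
    have h1 : Tendsto (fun i : ℕ => r ^ n * r⁻¹ ^ i) atTop (𝓝 (r ^ n * 0)) :=
      (tendsto_pow_atTop_nhds_zero_of_lt_one (by positivity) (inv_lt_one_of_one_lt₀ hr)).const_mul _
    rw [mul_zero] at h1
    refine h1.congr fun i => ?_
    rw [zpow_sub₀ hr0.ne', zpow_natCast, inv_pow, div_eq_mul_inv]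
  let c : ℕ → Fin k → (Fin N →₀ ℕ) → K := fun i j v =>
    MvPowerSeries.coeff v (H (n - i) (seq i) j).1
  have hB : ∀ j, 0 < B j := fun j => (hy.isLead j).pos
  have hc : ∀ i j v, ‖c i j v‖ * r ^ v.degree * B j ≤ r ^ (n - i) := fun i j v =>
    (hH (n - i) (seq i) (hgood i)).1 j v
  have hcle : ∀ i j v, ‖c i j v‖ ≤ r ^ (n - i) / (r ^ v.degree * B j) := fun i j v => by
    have := hB j
    rw [le_div_iff₀ (by positivity), ← mul_assoc]
    exact hc i j v
  have hcsum : ∀ j v, Summable fun i => c i j v := fun j v => by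
    refine summable_of_tendsto ?_
    rw [Nat.cofinite_eq_atTop]
    exact squeeze_zero_norm (fun i => hcle i j v) (by simpa using hpow.div_const _)
  have hbd : ∀ j v, ‖∑' i, c i j v‖ * r ^ v.degree * B j ≤ r ^ n := fun j v => by
    have := hB j
    rw [mul_assoc, ← le_div_iff₀ (by positivity)]
    refine IsUltrametricDist.norm_tsum_le_of_forall_le_of_nonneg (by positivity) fun i => ?_
    refine (hcle i j v).trans ?_
    gcongr
    · exact hr.le
    · omega
  -- The quotients are summed coefficientwise; the bound survives at the radius r > 1 itself, so the
  -- sums are overconvergent.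
  let h : Fin k → OverconvergentSeries p K N := fun j =>
    ⟨fun v => ∑' i, c i j v, r, hr, r ^ n / B j, fun v => by
      rw [le_div_iff₀ (hB j)]
      exact hbd j v⟩
  refine ⟨h, hbd, ?_⟩
  funext i₀
  refine Subtype.ext (MvPowerSeries.ext fun v => ?_)
  -- The coefficient at v involves only finitely many coefficients of the quotients, so
  -- coefficientwise convergence is enough.
  have hval : ∀ f : Fin k → OverconvergentSeries p K N,
      MvPowerSeries.coeff v ((∑ j, f j • y j) i₀).1 = ∑ j, ∑ q ∈ Finset.HasAntidiagonal.antidiagonal v,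
        MvPowerSeries.coeff q.1 (f j).1 * MvPowerSeries.coeff q.2 (y j i₀).1 := fun f => by
    rw [Finset.sum_apply, AddSubmonoidClass.coe_finsetSum, map_sum]
    refine Finset.sum_congr rfl fun j _ => ?_
    change MvPowerSeries.coeff v ((f j).1 * (y j i₀).1) = _
    rw [MvPowerSeries.coeff_mul]
  have hs1 : HasSum (fun i : ℕ => MvPowerSeries.coeff v
      ((∑ j, H (n - i) (seq i) j • y j) i₀).1) (MvPowerSeries.coeff v ((∑ j, h j • y j) i₀).1) := by
    simp only [hval]
    exact hasSum_sum fun j _ => hasSum_sum fun q _ => (hcsum j q.1).hasSum.mul_right _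
  have hs2 : ∀ m : ℕ, ∑ i ∈ Finset.range m, MvPowerSeries.coeff v
      ((∑ j, H (n - i) (seq i) j • y j) i₀).1 =
        MvPowerSeries.coeff v (g i₀).1 - MvPowerSeries.coeff v (seq m i₀).1 := fun m => by
    refine (Finset.sum_congr rfl fun i _ => ?_).trans
      (Finset.sum_range_sub' (fun i => MvPowerSeries.coeff v (seq i i₀).1) m)
    rw [hseq i]
    change _ = _ - MvPowerSeries.coeff v ((seq i i₀).1 - _)
    rw [map_sub, sub_sub_cancel]
  have hs3 : Tendsto (fun m : ℕ => MvPowerSeries.coeff v (seq m i₀).1) atTop (𝓝 0) := by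
    refine squeeze_zero_norm (a := fun m : ℕ => r ^ (n - m) / r ^ v.degree) (fun m => ?_)
      (by simpa using hpow.div_const _)
    rw [le_div_iff₀ (by positivity)]
    exact (hgood m).2.2 (i₀, v)
  refine tendsto_nhds_unique ?_ hs1.tendsto_sum_nat
  simp only [hs2]
  simpa using hs3.const_sub (MvPowerSeries.coeff v (g i₀).1)

end ExactDivision

/-! ### The coefficients in `K⟨x⟩†` of a series in `L†` -/

section Slice

variable {p : ℕ} [Fact p.Prime] {K : Type*} [NormedField K] [NormedAlgebra ℚ_[p] K]
  [FiniteDimensional ℚ_[p] K] {n N : ℕ} {A : Matrix (Fin n) (Fin N) ℤ}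

/-- A series in x alone is supported on t^0, so the infinite convolution collapses to a finite sum
over decompositions of v. -/
theorem coe_smul_apply (y : OverconvergentSeries p K N) (f : Ldagger p K A) (v : Fin N →₀ ℕ)
    (w : coneLattice A) : (y • f).1.1 (v, w) = ∑ q ∈ Finset.HasAntidiagonal.antidiagonal v,
      MvPowerSeries.coeff q.1 y.1 * f.1.1 (q.2, w) := by
  classical
  rw [Algebra.smul_def]
  change conv (inclFun K A y.1) f.1.1 (v, w) = _
  rw [conv_apply]
  let ι : ((Fin N →₀ ℕ) × (Fin N →₀ ℕ)) ↪
      ((Fin N →₀ ℕ) × coneLattice A) × ((Fin N →₀ ℕ) × coneLattice A) :=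
    ⟨fun q => ((q.1, 0), (q.2, w)), fun q q' h => by
      simp only [Prod.mk.injEq, and_true] at h
      exact Prod.ext h.1 h.2⟩
  rw [tsum_eq_sum (s := (Finset.HasAntidiagonal.antidiagonal v).map ι)]
  · rw [Finset.sum_map]
    refine Finset.sum_congr rfl fun q hq => ?_
    have hq' : (q.1, (0 : coneLattice A)) + (q.2, w) = (v, w) := by
      rw [Prod.mk_add_mk, Finset.HasAntidiagonal.mem_antidiagonal.mp hq, zero_add]
    have hι : ι q = ((q.1, 0), (q.2, w)) := rfl
    rw [hι, if_pos hq', inclFun, if_pos rfl]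
  · rintro ⟨⟨v1, w1⟩, ⟨v2, w2⟩⟩ h
    split_ifs with h3
    · by_cases h1 : w1 = 0
      · subst h1
        rw [Prod.mk_add_mk, Prod.mk.injEq, zero_add] at h3
        obtain ⟨h3, rfl⟩ := h3
        exact absurd (Finset.mem_map.mpr ⟨(v1, v2), Finset.HasAntidiagonal.mem_antidiagonal.mpr h3, rfl⟩) h
      · rw [inclFun, if_neg h1, zero_mul]
    · rfl

/-- The coefficient `f_w ∈ K⟨x⟩†` of `t^w` in `f ∈ L†`. -/
def slice (w : coneLattice A) : Ldagger p K A →ₗ[OverconvergentSeries p K N]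
    OverconvergentSeries p K N where
  toFun f := ⟨fun v => f.1.1 (v, w), by
    obtain ⟨r, hr, s, hs, C, hC⟩ := f.2
    refine ⟨r, hr, C / s ^ latticeDeg A w, fun v => ?_⟩
    have : 0 < s := by linarith
    rw [le_div_iff₀ (by positivity), mul_assoc]
    exact hC v w⟩
  map_add' _ _ := rfl
  map_smul' y f := by
    refine Subtype.ext (MvPowerSeries.ext fun v => ?_)
    change (y • f).1.1 (v, w) = MvPowerSeries.coeff v (y.1 * _)
    rw [coe_smul_apply, MvPowerSeries.coeff_mul]
    rfl

theorem coeff_slice (w : coneLattice A) (f : Ldagger p K A) (v : Fin N →₀ ℕ) :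
    MvPowerSeries.coeff v (slice w f).1 = f.1.1 (v, w) := rfl

theorem ext_slice {f g : Ldagger p K A} (h : ∀ w, slice w f = slice w g) : f = g := by
  refine Subtype.ext (Subtype.ext (funext fun ⟨v, w⟩ => ?_))
  rw [← coeff_slice, ← coeff_slice, h]

theorem exists_common_bound {l : ℕ} (f : Fin l → Ldagger p K A) :
    ∃ r : ℝ, 1 < r ∧ ∃ s : ℝ, 1 < s ∧ ∃ C : ℝ, 0 < C ∧ ∀ i v w,
      ‖(f i).1.1 (v, w)‖ * (r ^ v.degree * s ^ latticeDeg A w) ≤ C := by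
  choose r hr s hs C hC using fun i => (f i).2
  have hmin : ∀ a : Fin l → ℝ, (∀ i, 1 < a i) → ∃ b : ℝ, 1 < b ∧ ∀ i, b ≤ a i := fun a ha => by
    have h : ∀ᶠ b in 𝓝[>] (1 : ℝ), (∀ i, b ≤ a i) ∧ 1 < b :=
      (eventually_all.mpr fun i => (eventually_le_nhds (ha i)).filter_mono nhdsWithin_le_nhds).and
        self_mem_nhdsWithin
    obtain ⟨b, hb, hb'⟩ := h.exists
    exact ⟨b, hb', hb⟩
  obtain ⟨r', hr', hle⟩ := hmin r hr
  obtain ⟨s', hs', hle'⟩ := hmin s hs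
  obtain ⟨D, hD⟩ := (Set.finite_range C).bddAbove
  refine ⟨r', hr', s', hs', max D 1, by positivity, fun i v w => ?_⟩
  exact (mul_le_mul_of_nonneg_left (weight_mono A hr' hs' (hle i) (hle' i) (v, w))
    (norm_nonneg _)).trans ((hC i v w).trans ((hD ⟨i, rfl⟩).trans (le_max_left _ _)))

/-- If all coefficients of a tuple of members of `L†` lie in a submodule `M` of a finite free
module over `K⟨x⟩†`, then the tuple is a combination of finitely many members of `M`. -/
theorem exists_eq_sum_of_slice_mem {l : ℕ} (M : Submodule (OverconvergentSeries p K N)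
    (Fin l → OverconvergentSeries p K N)) (f : Fin l → Ldagger p K A)
    (hf : ∀ w, (fun i => slice w (f i)) ∈ M) :
    ∃ (k : ℕ) (y : Fin k → Fin l → OverconvergentSeries p K N) (h : Fin k → Ldagger p K A),
      (∀ j, y j ∈ M) ∧ ∀ i, f i = ∑ j, y j i • h j := by
  obtain ⟨r₀, hr₀, s, hs, C, hC0, hC⟩ := exists_common_bound f
  obtain ⟨r, hr, hrr₀, hK⟩ := exists_discrete_radius p K hr₀
  have hr0 : 0 < r := by linarith
  have hs0 : 0 < s := by linarith
  -- One standard basis, at one radius, serves all w at once.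
  obtain ⟨k, y, x, B, hy⟩ := exists_isStandardBasis r M
  have hB : ∀ j, 0 < B j := fun j => (hy.isLead j).pos
  have hbd : ∀ i v w, ‖(f i).1.1 (v, w)‖ * r₀ ^ v.degree ≤ C / s ^ latticeDeg A w :=
    fun i v w => by
      rw [le_div_iff₀ (by positivity), mul_assoc]
      exact hC i v w
  have hdiv : ∀ w, ∃ h : Fin k → OverconvergentSeries p K N,
      (∀ j v, ‖MvPowerSeries.coeff v (h j).1‖ * r ^ v.degree * B j ≤
        C / s ^ latticeDeg A w * r) ∧ (fun i => slice w (f i)) = ∑ j, h j • y j := fun w => by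
    -- Division needs a power of r as bound; rounding `C / s ^ latticeDeg A w` up to one costs at
    -- most a factor r, whatever w is.
    obtain ⟨m, hm, hm'⟩ := exists_mem_Ioc_zpow
      (show 0 < C / s ^ latticeDeg A w by positivity) hr
    obtain ⟨h, hh, heq⟩ := hy.exists_eq_sum hr hK (m + 1) _ (hf w)
      (fun i => isRestricted_of_bounded hr0 hrr₀ fun v => hbd i v w)
      (fun z => (mul_le_mul_of_nonneg_left (pow_le_pow_left₀ hr0.le hrr₀.le _)
        (norm_nonneg _)).trans ((hbd z.1 z.2 w).trans hm'))
    refine ⟨h, fun j v => (hh j v).trans ?_, heq⟩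
    rw [zpow_add_one₀ hr0.ne']
    exact mul_le_mul_of_nonneg_right hm.le hr0.le
  choose h hh heq using hdiv
  -- The constant no longer depends on w, so for each j the quotients are the coefficients of a
  -- single member of L†.
  have hbound : ∀ j v w, ‖MvPowerSeries.coeff v (h w j).1‖ * (r ^ v.degree * s ^ latticeDeg A w) ≤
      C * r / B j := fun j v w => by
    have hsw : 0 < s ^ latticeDeg A w := Real.rpow_pos_of_pos hs0 _
    have := hh w j v
    rw [div_mul_eq_mul_div, le_div_iff₀ hsw] at this
    rw [le_div_iff₀ (hB j)]
    linarith
  refine ⟨k, y, fun j => ⟨⟨fun m => MvPowerSeries.coeff m.1 (h m.2 j).1,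
    tendsto_of_bounded_weight p K A hr hs (hbound j)⟩, r, hr, s, hs, _, hbound j⟩, hy.mem,
    fun i => ext_slice fun w => ?_⟩
  rw [map_sum]
  have := congrFun (heq w) i
  rw [Finset.sum_apply] at this
  refine this.trans (Finset.sum_congr rfl fun j _ => ?_)
  rw [map_smul, smul_eq_mul, mul_comm, Pi.smul_apply, smul_eq_mul]
  rfl

variable (p K A) in
-- The equational criterion for flatness: the factorization through `LinearMap.ker φ` is precisely a
-- trivialization of the given relation.
theorem flat_Ldagger : Module.Flat (OverconvergentSeries p K N) (Ldagger p K A) := by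
  refine Module.Flat.of_forall_isTrivialRelation fun {l f g} hfg => ?_
  let φ : (Fin l → OverconvergentSeries p K N) →ₗ[OverconvergentSeries p K N]
      OverconvergentSeries p K N := ∑ i, f i • LinearMap.proj i
  have hφ : ∀ z, φ z = ∑ i, f i * z i := fun z => by simp [φ]
  obtain ⟨k, y, h, hy, hgh⟩ := exists_eq_sum_of_slice_mem (LinearMap.ker φ) g fun w => by
    rw [LinearMap.mem_ker, hφ]
    have := congrArg (slice w) hfg
    simpa using this
  exact ⟨k, fun i j => y j i, h, hgh, fun j => by rw [← hφ]; exact hy j⟩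

end Slice

/-! ### Specialization of `L†` at a point of the closed unit polydisc -/

section Specialization

theorem push_snd {K X Y : Type*} [NormedField K] (H : X × Y → K) (y : Y) :
    push Prod.snd H y = ∑' x, H (x, y) := by
  classical
  have hinj : Function.Injective fun x : X => (x, y) := fun x x' h => (Prod.mk.inj h).1
  rw [push, ← hinj.tsum_eq]
  · simp
  · rintro ⟨x, y'⟩ h
    have hy : y' = y := by
      by_contra hne
      simp [hne] at h
    exact ⟨x, by rw [hy]⟩

/-- The projection is additive, so both sides are sums of the same product family over the fibres of
the same map. -/
theorem push_snd_conv {K X Y : Type*} [NormedField K] [IsUltrametricDist K] [CompleteSpace K]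
    [AddCommMonoid X] [AddCommMonoid Y] {f g : X × Y → K} (hf : Tendsto f cofinite (𝓝 0))
    (hg : Tendsto g cofinite (𝓝 0)) :
    push Prod.snd (conv f g) = conv (push Prod.snd f) (push Prod.snd g) := by
  rw [conv_eq_push, conv_eq_push, push_push _ _ (prod_tendsto hf hg), push_prod _ _ hf hg,
    push_push _ _ (prod_tendsto hf hg)]
  rfl

variable {p : ℕ} [Fact p.Prime] {K : Type*} [NormedField K] [NormedAlgebra ℚ_[p] K] {n N : ℕ}
  {K' : Type*} [NormedField K'] [NormedAlgebra ℚ_[p] K'] [FiniteDimensional ℚ_[p] K']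
  [NormedAlgebra K K'] {A : Matrix (Fin n) (Fin N) ℤ}

/-- The family `a_{vw} a^v` attached to `∑ a_{vw} x^v t^w`. -/
def twist (a : Fin N → K') (f : (Fin N →₀ ℕ) × coneLattice A → K)
    (m : (Fin N →₀ ℕ) × coneLattice A) : K' :=
  algebraMap K K' (f m) * ∏ i, a i ^ m.1 i

theorem twist_tendsto {a : Fin N → K'} (ha : ∀ i, ‖a i‖ ≤ 1)
    {f : (Fin N →₀ ℕ) × coneLattice A → K} (hf : Tendsto f cofinite (𝓝 0)) :
    Tendsto (twist a f) cofinite (𝓝 0) := by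
  refine squeeze_zero_norm (fun m => ?_) (tendsto_norm_zero.comp hf)
  rw [twist, norm_mul, norm_algebraMap']
  exact mul_le_of_le_one_right (norm_nonneg _) (norm_monomial_le K' ha m.1)

/-- Specialization is the twist by a^v followed by summation over v. The twist respects convolution
because v ↦ a^v is multiplicative. -/
theorem twist_conv [IsUltrametricDist K] [CompleteSpace K] (a : Fin N → K')
    {f g : (Fin N →₀ ℕ) × coneLattice A → K} (hf : Tendsto f cofinite (𝓝 0))
    (hg : Tendsto g cofinite (𝓝 0)) : twist a (conv f g) = conv (twist a f) (twist a g) := by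
  funext m
  have hs : Summable fun q : {q : ((Fin N →₀ ℕ) × coneLattice A) ×
      ((Fin N →₀ ℕ) × coneLattice A) // q.1 + q.2 = m} => f q.1.1 * g q.1.2 :=
    (summable_of_tendsto (prod_tendsto hf hg)).subtype _
  rw [twist, conv, hs.map_tsum (algebraMap K K') (algebraMapCLM K K').continuous, ← tsum_mul_right]
  refine tsum_congr ?_
  rintro ⟨q, rfl⟩
  rw [map_mul, twist, twist, Prod.fst_add]
  simp only [Finsupp.add_apply, pow_add, Finset.prod_mul_distrib]
  ring

theorem evalHom_apply (a : Fin N → K') (ha : ∀ i, ‖a i‖ ≤ 1) (f : OverconvergentSeries p K N) :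
    evalHom p K K' a ha f =
      ∑' v, algebraMap K K' (MvPowerSeries.coeff v f.1) * ∏ i, a i ^ v i := rfl

theorem evalHom_algebraMap (a : Fin N → K') (ha : ∀ i, ‖a i‖ ≤ 1) (c : K) :
    evalHom p K K' a ha (algebraMap K _ c) = algebraMap K K' c := by
  classical
  have hcoeff : ∀ v : Fin N →₀ ℕ, MvPowerSeries.coeff v
      (algebraMap K (OverconvergentSeries p K N) c).1 = if v = 0 then c else 0 := fun v => by
    rw [← MvPowerSeries.coeff_C]
    rfl
  rw [evalHom_apply, tsum_eq_single 0 fun v hv => by rw [hcoeff, if_neg hv, map_zero, zero_mul],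
    hcoeff]
  simp

variable [FiniteDimensional ℚ_[p] K]

theorem evalHom_slice (a : Fin N → K') (ha : ∀ i, ‖a i‖ ≤ 1) (f : Ldagger p K A)
    (w : coneLattice A) : evalHom p K K' a ha (slice w f) = push Prod.snd (twist a f.1.1) w := by
  rw [push_snd]
  rfl

open scoped Classical in
theorem slice_algebraMap (y : OverconvergentSeries p K N)
    (w : coneLattice A) :
    slice w (algebraMap _ (Ldagger p K A) y) = if w = 0 then y else 0 := by
  refine Subtype.ext (MvPowerSeries.ext fun v => ?_)
  change inclFun K A y.1 (v, w) = _
  rw [inclFun]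
  split_ifs <;> rfl

/-- The homomorphism `L† → L₀†`, `∑ f_w t^w ↦ ∑ f_w(a) t^w`. -/
def specialize (a : Fin N → K') (ha : ∀ i, ‖a i‖ ≤ 1) : Ldagger p K A →+* LdaggerZero p K' A where
  toFun f := by
    have hbd : ∃ s : ℝ, 1 < s ∧ ∃ C : ℝ, ∀ w : coneLattice A,
        ‖evalHom p K K' a ha (slice w f)‖ * s ^ latticeDeg A w ≤ C := by
      obtain ⟨r, hr, s, hs, C, hC⟩ := f.2
      have := isUltrametricDist p K'
      have hs0 : 0 < s := by linarith
      have hC0 : 0 ≤ C := le_trans (by have : 0 < r := by linarith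
                                       positivity) (hC 0 0)
      refine ⟨s, hs, C, fun w => ?_⟩
      have hsw : 0 < s ^ latticeDeg A w := Real.rpow_pos_of_pos hs0 _
      rw [← le_div_iff₀ hsw]
      -- Each term is bounded separately: a^v has norm at most 1 and r^{|v|} is at least 1, so the
      -- bound C on f carries over with the same s.
      refine IsUltrametricDist.norm_tsum_le_of_forall_le_of_nonneg (by positivity) fun v => ?_
      rw [norm_mul, norm_algebraMap', le_div_iff₀ hsw]
      refine le_trans ?_ (hC v w)
      refine mul_le_mul (mul_le_of_le_one_right (norm_nonneg _) (norm_monomial_le K' ha v))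
        (le_mul_of_one_le_left hsw.le (one_le_pow₀ hr.le)) hsw.le (norm_nonneg _)
    exact ⟨⟨fun w => evalHom p K K' a ha (slice w f), by
      obtain ⟨s, hs, C, hC⟩ := hbd
      exact tendsto_of_bounded_rpow p K' A hs hC⟩, hbd⟩
  map_one' := by
    classical
    refine Subtype.ext (Subtype.ext (funext fun w => ?_))
    change evalHom p K K' a ha (slice w 1) = (1 : nullFam p K' (coneLattice A)).1 w
    rw [coe_one_apply, ← map_one (algebraMap (OverconvergentSeries p K N) (Ldagger p K A)),
      slice_algebraMap]
    split_ifs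
    · exact map_one _
    · exact map_zero _
  map_zero' := by
    refine Subtype.ext (Subtype.ext (funext fun w => ?_))
    change evalHom p K K' a ha (slice w 0) = 0
    rw [map_zero, map_zero]
  map_add' f g := by
    refine Subtype.ext (Subtype.ext (funext fun w => ?_))
    change evalHom p K K' a ha (slice w (f + g)) =
      evalHom p K K' a ha (slice w f) + evalHom p K K' a ha (slice w g)
    rw [map_add, map_add]
  map_mul' f g := by
    have := isUltrametricDist p K
    have := completeSpace p K
    have := isUltrametricDist p K'
    have := completeSpace p K'
    have hval : ∀ f : Ldagger p K A, (fun w => evalHom p K K' a ha (slice w f)) =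
        push Prod.snd (twist a f.1.1) := fun f => funext (evalHom_slice a ha f)
    refine Subtype.ext (Subtype.ext ?_)
    change (fun w => evalHom p K K' a ha (slice w (f * g))) =
      conv (fun w => evalHom p K K' a ha (slice w f)) (fun w => evalHom p K K' a ha (slice w g))
    rw [hval, hval, hval, ← push_snd_conv (twist_tendsto ha f.1.2) (twist_tendsto ha g.1.2),
      ← twist_conv a f.1.2 g.1.2]
    rfl

theorem specialize_algebraMap (a : Fin N → K') (ha : ∀ i, ‖a i‖ ≤ 1)
    (y : OverconvergentSeries p K N) : specialize a ha (algebraMap _ (Ldagger p K A) y) =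
      algebraMap K' (LdaggerZero p K' A) (evalHom p K K' a ha y) := by
  classical
  refine Subtype.ext (Subtype.ext (funext fun w => ?_))
  change evalHom p K K' a ha (slice w _) =
    (algebraMap K' (nullFam p K' (coneLattice A)) (evalHom p K K' a ha y)).1 w
  rw [slice_algebraMap, Algebra.algebraMap_eq_smul_one]
  change _ = evalHom p K K' a ha y • (1 : nullFam p K' (coneLattice A)).1 w
  rw [coe_one_apply]
  split_ifs
  · rw [smul_eq_mul, mul_one]
  · rw [map_zero, smul_zero]

end Specialization

/-! ### Lifting series of L₀† to series constant in x -/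

section ConstantLift

variable {p : ℕ} [Fact p.Prime] {K : Type*} [NormedField K] [NormedAlgebra ℚ_[p] K]
  [FiniteDimensional ℚ_[p] K] {n N : ℕ} {K' : Type*} [NormedField K'] [NormedAlgebra ℚ_[p] K']
  [FiniteDimensional ℚ_[p] K'] {A : Matrix (Fin n) (Fin N) ℤ}

/-- The series `∑ φ(g_w) t^w` in `L†` attached to a series `∑ g_w t^w` in `L₀†` and a bounded
linear map `φ`. -/
def constantLift (φ : K' →L[ℚ_[p]] K) (g : LdaggerZero p K' A) : Ldagger p K A := by
  classical
  have hbd : ∃ r : ℝ, 1 < r ∧ ∃ s : ℝ, 1 < s ∧ ∃ C : ℝ, ∀ (v : Fin N →₀ ℕ) (w : coneLattice A),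
      ‖if v = 0 then φ (g.1.1 w) else 0‖ * (r ^ v.degree * s ^ latticeDeg A w) ≤ C := by
    obtain ⟨s, hs, C, hC⟩ := g.2
    have hs0 : 0 < s := by linarith
    have hC0 : 0 ≤ C := le_trans (by positivity) (hC 0)
    -- The radius 2 is arbitrary, since only v = 0 contributes.
    refine ⟨2, one_lt_two, s, hs, ‖φ‖ * C, fun v w => ?_⟩
    split_ifs with hv
    · subst hv
      rw [map_zero, pow_zero, one_mul]
      calc _ ≤ ‖φ‖ * ‖g.1.1 w‖ * s ^ latticeDeg A w := by
            gcongr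
            exact φ.le_opNorm _
        _ ≤ ‖φ‖ * C := by
            rw [mul_assoc]
            exact mul_le_mul_of_nonneg_left (hC w) (norm_nonneg _)
    · rw [norm_zero, zero_mul]
      positivity
  exact ⟨⟨fun m => if m.1 = 0 then φ (g.1.1 m.2) else 0, by
    obtain ⟨r, hr, s, hs, C, hC⟩ := hbd
    exact tendsto_of_bounded_weight p K A hr hs hC⟩, hbd⟩

theorem slice_constantLift (φ : K' →L[ℚ_[p]] K) (g : LdaggerZero p K' A) (w : coneLattice A) :
    slice w (constantLift φ g) = algebraMap K _ (φ (g.1.1 w)) := by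
  classical
  refine Subtype.ext (MvPowerSeries.ext fun v => ?_)
  refine Eq.trans ?_ (MvPowerSeries.coeff_C v (φ (g.1.1 w))).symm
  change (if v = 0 then φ (g.1.1 w) else 0) = _
  congr

end ConstantLift

/-! ### Base change of L† along evaluation at a -/

section TensorProduct

variable {p : ℕ} [Fact p.Prime] {K : Type*} [NormedField K] [NormedAlgebra ℚ_[p] K]
  [FiniteDimensional ℚ_[p] K] {n N : ℕ} {K' : Type*} [NormedField K'] [NormedAlgebra ℚ_[p] K']
  [FiniteDimensional ℚ_[p] K'] [NormedAlgebra K K']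
  {A : Matrix (Fin n) (Fin N) ℤ} {a : Fin N → K'} {ha : ∀ i, ‖a i‖ ≤ 1}
  [Algebra (OverconvergentSeries p K N) K']

/-- A basis of `K'` over `K` generates `K' ⊗ L†` over `L†`. -/
theorem exists_eq_sum_basis_tmul
    (hev : ∀ f, algebraMap (OverconvergentSeries p K N) K' f = evalHom p K K' a ha f)
    {d : ℕ} (e : Module.Basis (Fin d) K K') (z : K' ⊗[OverconvergentSeries p K N] Ldagger p K A) :
    ∃ f : Fin d → Ldagger p K A, z = ∑ i, e i ⊗ₜ f i := by
  induction z with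
  | zero => exact ⟨0, by simp⟩
  | tmul c f =>
    refine ⟨fun i => algebraMap K (OverconvergentSeries p K N) (e.repr c i) • f, ?_⟩
    conv_lhs => rw [← e.sum_repr c]
    rw [TensorProduct.sum_tmul]
    refine Finset.sum_congr rfl fun i _ => ?_
    -- Evaluation at a is the structure map on constants, so scalars of K pass across the tensor
    -- product over K⟨x⟩†.
    rw [← TensorProduct.smul_tmul, Algebra.smul_def, Algebra.smul_def, hev, evalHom_algebraMap]
  | add z z' hz hz' =>
    obtain ⟨f, rfl⟩ := hz
    obtain ⟨g, rfl⟩ := hz'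
    exact ⟨f + g, by simp [TensorProduct.tmul_add, Finset.sum_add_distrib]⟩

theorem exists_algEquiv_LdaggerZero [FiniteDimensional K K'] [IsScalarTower ℚ_[p] K K']
    (hev : ∀ f, algebraMap (OverconvergentSeries p K N) K' f = evalHom p K K' a ha f) :
    ∃ e : K' ⊗[OverconvergentSeries p K N] Ldagger p K A ≃ₐ[K'] LdaggerZero p K' A,
      ∀ (c : K') (f : Ldagger p K A) (w : coneLattice A),
        (e (c ⊗ₜ f)).1.1 w = c * evalHom p K K' a ha (slice w f) := by
  let _ : Algebra (OverconvergentSeries p K N) (LdaggerZero p K' A) :=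
    ((algebraMap K' (LdaggerZero p K' A)).comp
      (algebraMap (OverconvergentSeries p K N) K')).toAlgebra
  have : IsScalarTower (OverconvergentSeries p K N) K' (LdaggerZero p K' A) :=
    IsScalarTower.of_algebraMap_eq' rfl
  let σ : Ldagger p K A →ₐ[OverconvergentSeries p K N] LdaggerZero p K' A :=
    { specialize a ha with
      commutes' := fun y => by
        refine (specialize_algebraMap a ha y).trans ?_
        rw [← hev]
        rfl }
  let ψ : K' ⊗[OverconvergentSeries p K N] Ldagger p K A →ₐ[K'] LdaggerZero p K' A :=
    Algebra.TensorProduct.lift (Algebra.ofId K' _) σ fun _ _ => Commute.all _ _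
  have hψ : ∀ (c : K') (f : Ldagger p K A) (w : coneLattice A),
      (ψ (c ⊗ₜ f)).1.1 w = c * evalHom p K K' a ha (slice w f) := fun c f w => by
    have h : ψ (c ⊗ₜ f) = c • specialize a ha f := by
      rw [Algebra.smul_def]
      exact Algebra.TensorProduct.lift_tmul _ _ _ c f
    rw [h]
    rfl
  let e := Module.finBasis K K'
  have hψsum : ∀ (f : Fin _ → Ldagger p K A) (w : coneLattice A),
      (ψ (∑ i, e i ⊗ₜ f i)).1.1 w = ∑ i, e i * evalHom p K K' a ha (slice w (f i)) := fun f w => by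
    rw [map_sum, AddSubmonoidClass.coe_finsetSum, AddSubmonoidClass.coe_finsetSum,
      Finset.sum_apply]
    exact Finset.sum_congr rfl fun i _ => hψ _ _ _
  refine ⟨AlgEquiv.ofBijective ψ ⟨?_, fun g => ?_⟩, hψ⟩
  · refine (injective_iff_map_eq_zero ψ).mpr fun z hz => ?_
    obtain ⟨f, rfl⟩ := exists_eq_sum_basis_tmul hev e z
    -- The vanishing of the image of z says exactly that every coefficient tuple of f lies in the
    -- kernel of y ↦ ∑ y_i(a) e_i. Expanding f through members of this kernel and moving their
    -- entries to the left factor makes each term vanish.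
    let φ : (Fin _ → OverconvergentSeries p K N) →ₗ[OverconvergentSeries p K N] K' :=
      Fintype.linearCombination (OverconvergentSeries p K N) e
    have hφ : ∀ y, φ y = ∑ i, y i • e i := fun y => Fintype.linearCombination_apply _ _ _
    obtain ⟨k, y, h, hy, hfh⟩ := exists_eq_sum_of_slice_mem (LinearMap.ker φ) f fun w => by
      rw [LinearMap.mem_ker, hφ]
      have h0 := hψsum f w
      rw [hz] at h0
      refine Eq.trans (Finset.sum_congr rfl fun i _ => ?_) h0.symm
      rw [Algebra.smul_def, hev, mul_comm]
    calc ∑ i, e i ⊗ₜ[OverconvergentSeries p K N] f i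
        = ∑ j, ∑ i, (y j i • e i) ⊗ₜ[OverconvergentSeries p K N] h j := by
          rw [Finset.sum_comm]
          refine Finset.sum_congr rfl fun i _ => ?_
          rw [hfh i, TensorProduct.tmul_sum]
          exact Finset.sum_congr rfl fun j _ => (TensorProduct.smul_tmul _ _ _).symm
      _ = 0 := Finset.sum_eq_zero fun j _ => by
          rw [← TensorProduct.sum_tmul, ← hφ, LinearMap.mem_ker.mp (hy j), TensorProduct.zero_tmul]
  -- Coordinates in the basis e are continuous, by finite dimension over ℚ_p, so they preserve the
  -- decay in w and can be lifted.
  · let φ : Fin _ → K' →L[ℚ_[p]] K := fun i =>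
      LinearMap.toContinuousLinearMap ((e.coord i).restrictScalars ℚ_[p])
    refine ⟨∑ i, e i ⊗ₜ constantLift (φ i) g, Subtype.ext (Subtype.ext (funext fun w => ?_))⟩
    rw [hψsum]
    refine Eq.trans (Finset.sum_congr rfl fun i _ => ?_) (e.sum_repr (g.1.1 w))
    rw [slice_constantLift, evalHom_algebraMap, mul_comm, ← Algebra.smul_def]
    rfl

end TensorProduct

end GKZ

end
theorem lemma3 (p : ℕ) [Fact p.Prime]
    (K : Type*) [NormedField K] [NormedAlgebra ℚ_[p] K] [FiniteDimensional ℚ_[p] K]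
    (_hK : ∃ π : K, π ^ (p - 1) + (p : K) = 0)
    {n N : ℕ} (A : Matrix (Fin n) (Fin N) ℤ) (_hA : (A.map (Int.cast : ℤ → ℚ)).rank = n)
    (K' : Type*) [NormedField K'] [NormedAlgebra ℚ_[p] K'] [FiniteDimensional ℚ_[p] K']
    [NormedAlgebra K K'] [FiniteDimensional K K'] [IsScalarTower ℚ_[p] K K']
    (a : Fin N → K') (ha : ∀ i, ‖a i‖ ≤ 1) :
    Module.Flat (GKZ.OverconvergentSeries p K N) (GKZ.Ldagger p K A) ∧
    letI : Algebra (GKZ.OverconvergentSeries p K N) K' := (GKZ.evalHom p K K' a ha).toAlgebra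
    ∃ e : K' ⊗[GKZ.OverconvergentSeries p K N] GKZ.Ldagger p K A ≃ₐ[K'] GKZ.LdaggerZero p K' A,
      ∀ (c : K') (f : GKZ.Ldagger p K A) (w : GKZ.coneLattice A),
        (e (c ⊗ₜ f)).1.1 w =
          c * ∑' v : Fin N →₀ ℕ, algebraMap K K' (f.1.1 (v, w)) * ∏ i, a i ^ v i := by
  let _ : Algebra (GKZ.OverconvergentSeries p K N) K' := (GKZ.evalHom p K K' a ha).toAlgebra
  exact ⟨GKZ.flat_Ldagger p K A, GKZ.exists_algEquiv_LdaggerZero (ha := ha) fun _ => rfl⟩
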